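/- \textbf{Setting.} Let $(\Omega,\mathcal B,\mu)$ be a probability space and $T:\Omega\to\Omega$ a measurable, $\mu$-preserving, mixing transformation. Let $\widehat T$ be its transfer operator on $L^1(\mu)$, determined by $\int \widehat Tf\cdot g\,d\mu=\int f\cdot g\circ T\,d\mu$ for $f\in L^1(\mu)$, $g\in L^\infty(\mu)$. Let $\mathcal F$ be a set of (real or complex valued) measurable functions, identified when equal $\mu$-a.e., which contains the constants, is a Banach algebra for a norm $\|\cdot\|$, and satisfies $\|f\|\ge|f|_\infty$ for all $f\in\mathcal F$, where $|\cdot|_\infty$ is the $\mu$-essential supremum norm. Assume that $\widehat T$ maps $\mathcal F$ to itself, is bounded with respect to $\|\cdot\|$ and has a spectral gap on $\mathcal F$: $\widehat T=\lambda P+N$ on $\mathcal F$ with a scalar $\lambda$ and bounded linear operators $P,N$ such that $P^2=P$, $\dim \operatorname{Im}P=1$, $PN=NP=0$, and the spectral radius of $N$ is smaller than $|\lambda|$. Let $\chi:\Omega\to\mathbb R_{\ge0}$ be measurable and put ${}^{\ell}\chi=\chi\cdot\mathbf 1_{\{\chi\le\ell\}}$. Assume that there are $K_1,K_2>0$ such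 that for every $\ell>0$ the functions ${}^{\ell}\chi$ and $\mathbf 1_{\{\chi>\ell\}}$ belong to $\mathcal F$, with $\|{}^{\ell}\chi\|\le K_1\ell$ and $\|\mathbf 1_{\{\chi>\ell\}}\|\le K_2$. (All of this together is Property $\mathfrak D$.) \textbf{Theorem.} Let $\eta>1$, $q\in(1/\eta,1)$ and $0<R<1/q$, and assume that $\mu(\chi=\eta^k)=R\,q^k$ for all integers $k\ge1$. Let $(f_n)_{n\ge1}$ be a sequence of positive reals with $\mu(\chi\le f_n)>0$ for all $n$ and $f_n\to\infty$. Suppose that there is a sequence $\psi$ of positive reals with $\sum_{n\ge1}1/\psi(n)<\infty$ such that $$f_n^{-\log q/\log\eta}=o\!\left(\frac{n}{\log\psi(\lfloor\log n\rfloor)}\right)\qquad(n\to\infty).$$ Then the truncated sums $\mathsf T_n^{f_n}\chi=\sum_{i=0}^{n-1}({}^{f_n}\chi)\circ T^{i}$ satisfy $$\lim_{n\to\infty}\frac{\mathsf T_n^{f_n}\chi}{\int\mathsf T_n^{f_n}\chi\,d\mu}=1\qquad\mu\text{-almost surely.}$$ -/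

import Mathlib

open MeasureTheory Filter Topology
open scoped ENNReal NNReal

/-- The spectral radius `lim ‖N ^ n‖ ^ (1 / n)` of a bounded operator. Over `ℂ` it is Mathlib's
`spectralRadius` (see `opSpectralRadius_eq`); over `ℝ` it is the spectral radius of the
complexification, which the spectrum over `ℝ` alone would not give. -/
noncomputable def opSpectralRadius {𝕜 F : Type*} [RCLike 𝕜] [NormedAddCommGroup F]
    [NormedSpace 𝕜 F] (N : F →L[𝕜] F) : ℝ≥0∞ :=
  limsup (fun n : ℕ => (‖N ^ n‖₊ : ℝ≥0∞) ^ (1 / n : ℝ)) atTop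

theorem opSpectralRadius_eq {F : Type*} [NormedAddCommGroup F] [NormedSpace ℂ F]
    [CompleteSpace F] (N : F →L[ℂ] F) : opSpectralRadius N = spectralRadius ℂ N :=
  (spectrum.pow_nnnorm_pow_one_div_tendsto_nhds_spectralRadius N).limsup_eq

/-- `U` has a spectral gap: `U = c P + N` with `P` a projection of rank one, `P N = N P = 0`
and the spectral radius of `N` smaller than `|c|`. -/
def HasSpectralGap {𝕜 F : Type*} [RCLike 𝕜] [NormedAddCommGroup F] [NormedSpace 𝕜 F]
    (U : F →L[𝕜] F) : Prop :=
  ∃ (c : 𝕜) (P N : F →L[𝕜] F),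
    U = c • P + N ∧
    P * P = P ∧ Module.finrank 𝕜 (LinearMap.range (P : F →ₗ[𝕜] F)) = 1 ∧
    opSpectralRadius N < (‖c‖₊ : ℝ≥0∞) ∧
    P * N = 0 ∧ N * P = 0

/-- `g` is the image of the integrable function `f` under the transfer operator of `T`:
`∫ g h dμ = ∫ f (h ∘ T) dμ` for all bounded measurable `h`. -/
def IsTransferImage {Ω 𝕜 : Type*} [RCLike 𝕜] [MeasurableSpace Ω] (μ : Measure Ω) (T : Ω → Ω)
    (f g : Ω → 𝕜) : Prop :=
  Integrable f μ ∧ Integrable g μ ∧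
    ∀ h : Ω → 𝕜, Measurable h → (∃ C : ℝ, ∀ ω, ‖h ω‖ ≤ C) →
      ∫ ω, g ω * h ω ∂μ = ∫ ω, f ω * h (T ω) ∂μ

/-- The transfer operator is uniquely determined up to null sets. -/
theorem IsTransferImage.unique {Ω 𝕜 : Type*} [RCLike 𝕜] [MeasurableSpace Ω] {μ : Measure Ω}
    {T : Ω → Ω} {f g₁ g₂ : Ω → 𝕜} (h₁ : IsTransferImage μ T f g₁)
    (h₂ : IsTransferImage μ T f g₂) : g₁ =ᵐ[μ] g₂ := by
  refine Integrable.ae_eq_of_forall_setIntegral_eq _ _ h₁.2.1 h₂.2.1 fun s hs _ => ?_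
  have hm : Measurable (s.indicator (fun _ => (1 : 𝕜))) := measurable_const.indicator hs
  have hb : ∃ C : ℝ, ∀ ω, ‖s.indicator (fun _ => (1 : 𝕜)) ω‖ ≤ C :=
    ⟨1, fun ω => by by_cases hω : ω ∈ s <;> simp [hω]⟩
  have key : ∀ g : Ω → 𝕜, ∫ ω, g ω * s.indicator (fun _ => (1 : 𝕜)) ω ∂μ = ∫ ω in s, g ω ∂μ := by
    intro g
    rw [← integral_indicator hs]
    congr 1
    ext ω
    by_cases hω : ω ∈ s <;> simp [hω]
  rw [← key, ← key, h₁.2.2 _ hm hb, h₂.2.2 _ hm hb]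

/-- `T` is (strongly) mixing for `μ`. -/
def IsMixing {Ω : Type*} [MeasurableSpace Ω] (μ : Measure Ω) (T : Ω → Ω) : Prop :=
  ∀ A B : Set Ω, MeasurableSet A → MeasurableSet B →
    Tendsto (fun n : ℕ => μ (A ∩ T^[n] ⁻¹' B)) atTop (𝓝 (μ A * μ B))

/-- Property C for the Banach algebra `F` of measurable functions. A Banach algebra of (real or
complex valued) measurable functions, taken modulo null sets, is a complete normed algebra `F`
together with an injective linear multiplicative map `ι` to the classes of all such functions;
`F` contains the constant functions, as `ι` is linear and hits the constant `1`. -/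
structure PropertyC {Ω 𝕜 F : Type*} [RCLike 𝕜] [MeasurableSpace Ω] (μ : Measure Ω) (T : Ω → Ω)
    [NormedCommRing F] [NormedAlgebra 𝕜 F] [CompleteSpace F]
    (ι : F →ₗ[𝕜] (Ω →ₘ[μ] 𝕜)) : Prop where
  injective : Function.Injective ι
  map_mul : ∀ f g : F, ι (f * g) = ι f * ι g
  map_one : ι 1 = 1
  prob : IsProbabilityMeasure μ
  invariant : MeasurePreserving T μ μ
  mixing : IsMixing μ T
  sup_le_norm : ∀ f : F, eLpNorm (ι f) ∞ μ ≤ ENNReal.ofReal ‖f‖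
  /-- The transfer operator acts on `F` as a bounded operator with a spectral gap. -/
  transfer : ∃ U : F →L[𝕜] F,
    (∀ f : F, IsTransferImage μ T (ι f) (ι (U f))) ∧ HasSpectralGap U

/-- The truncation `χ · 1_{χ ≤ ℓ}`. -/
noncomputable def upperTrunc {Ω : Type*} (χ : Ω → ℝ) (ℓ : ℝ) : Ω → ℝ :=
  {ω | χ ω ≤ ℓ}.indicator χ

/-- Property D: Property C holds and `χ` is a nonnegative measurable function, in general
unbounded, such that for all `ℓ > 0` the functions `χ · 1_{χ ≤ ℓ}` and `1_{χ > ℓ}` belong to `F`,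
with norm at most `K₁ ℓ` and at most `K₂`. -/
structure PropertyD {Ω 𝕜 F : Type*} [RCLike 𝕜] [MeasurableSpace Ω] (μ : Measure Ω) (T : Ω → Ω)
    [NormedCommRing F] [NormedAlgebra 𝕜 F] [CompleteSpace F]
    (ι : F →ₗ[𝕜] (Ω →ₘ[μ] 𝕜)) (χ : Ω → ℝ) : Prop where
  propertyC : PropertyC μ T ι
  measurable : Measurable χ
  nonneg : ∀ ω, 0 ≤ χ ω
  trunc_bound : ∃ K₁ : ℝ, 0 < K₁ ∧ ∀ ℓ : ℝ, 0 < ℓ →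
    ∃ g : F, (ι g =ᵐ[μ] fun ω => ((upperTrunc χ ℓ ω : ℝ) : 𝕜)) ∧ ‖g‖ ≤ K₁ * ℓ
  tail_bound : ∃ K₂ : ℝ, 0 < K₂ ∧ ∀ ℓ : ℝ, 0 < ℓ →
    ∃ g : F, (ι g =ᵐ[μ] {ω | ℓ < χ ω}.indicator fun _ => (1 : 𝕜)) ∧ ‖g‖ ≤ K₂

/-- The truncated sum `∑_{i < n} (χ · 1_{χ ≤ ℓ}) ∘ T ^ i`. -/
noncomputable def truncSum {Ω : Type*} (T : Ω → Ω) (χ : Ω → ℝ) (ℓ : ℝ) (n : ℕ) : Ω → ℝ :=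
  birkhoffSum T (upperTrunc χ ℓ) n

/-- The class `Ψ` of positive sequences `(u n)`, `n ≥ 1`, with `∑ 1 / u n < ∞`
(the value `u 0` is irrelevant). -/
def PsiClass : Set (ℕ → ℝ) :=
  {u | (∀ n, 1 ≤ n → 0 < u n) ∧ Summable fun n : ℕ => 1 / u n}

/-!
The proof rests on an exponential deviation bound at the scale of the mean. Write
`G ℓ = ∫ upperTrunc χ ℓ` and let `φ = upperTrunc χ ℓ / ℓ`, an element of the algebra with values in
`[0, 1]` and norm bounded independently of `ℓ`.

The spectral gap takes the form `U g = (∫ g) • 1 + N g` with `N 1 = 0` and `N ^ n` decaying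
exponentially (`PropertyC.exists_transfer_eq`). The integral `A n` of `∏_{i < n} (1 + t φ ∘ T ^ i)`
is the integral of `g n`, where `g (n + 1) = U ((1 + t φ) g n)` and `g 0 = 1`. Splitting
`g n = A n • 1 + h n`, an induction gives `‖h n‖ = O(|t|) A n`, and since `∫ φ h` is at most
`(∫ φ) ‖h‖`, one step multiplies `A n` by at most `1 + (∫ φ) (t + O(t ^ 2))`
(`PropertyC.exists_integral_prod_le`). The error is proportional to `∫ φ`, so Markov's inequality
bounds the probability that the truncated sum of length `n` leaves `[1 - ε, 1 + ε] * (n * G ℓ)` by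
`2 exp (-c n G ℓ / ℓ)`, with `c` independent of `ℓ` (`PropertyD.exists_truncSum_deviation_le`).

The distribution of `χ` off the powers of `η` is arbitrary and the levels `f n` need not be
monotone, so the bound is needed for all levels at once. On `[η ^ j, η ^ (j + 1)]` this costs only
a constant, because truncated sums are monotone in the level
(`PropertyD.exists_uniform_deviation_le`). Moreover `n * G (η ^ j) / η ^ (j + 1)` is at least a
constant times `n * q ^ j`, which is geometric in `j`; so all `j` with `n * q ^ j ≥ y` together cost
`O(exp (-c y))` (`PropertyD.exists_measure_deviationSet_le`). The growth condition on `f` says that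
the level `f n` is admissible for `y` any multiple of `log (ψ k)`, where `k = ⌊log n⌋`, which makes
the cost `O(1 / ψ k)`. Truncated sums are also monotone in `n`, so boundedly many times per block
`k ≤ log n < k + 1` suffice, and the Borel–Cantelli lemma applies
(`PropertyD.ae_eventually_le_truncSum_le`).
-/

/-! ### Powers of an operator with small spectral radius -/

theorem exists_norm_pow_le_of_opSpectralRadius_lt_one {𝕜 F : Type*} [RCLike 𝕜]
    [NormedAddCommGroup F] [NormedSpace 𝕜 F] {N : F →L[𝕜] F} (h : opSpectralRadius N < 1) :
    ∃ C θ : ℝ, 0 < C ∧ 0 < θ ∧ θ < 1 ∧ ∀ n : ℕ, ‖N ^ n‖ ≤ C * θ ^ n := by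
  obtain ⟨r, hr, hr1⟩ := ENNReal.lt_iff_exists_nnreal_btwn.1 h
  have hr1' : (r : ℝ) < 1 := by exact_mod_cast hr1
  have hr0 : (0 : ℝ) < r := by
    have : (0 : ℝ≥0∞) < r := pos_of_gt hr
    exact_mod_cast this
  obtain ⟨n₀, hn₀⟩ := eventually_atTop.1 (eventually_lt_of_limsup_lt hr)
  have key : ∀ n, max n₀ 1 ≤ n → ‖N ^ n‖ ≤ (r : ℝ) ^ n := by
    intro n hn
    have hn1 : 1 ≤ n := (le_max_right _ _).trans hn
    have h1 := (hn₀ n ((le_max_left _ _).trans hn)).le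
    have hn0 : (n : ℝ) ≠ 0 := by positivity
    have h2 : (‖N ^ n‖₊ : ℝ≥0∞) ≤ (r : ℝ≥0∞) ^ n := by
      calc (‖N ^ n‖₊ : ℝ≥0∞) = ((‖N ^ n‖₊ : ℝ≥0∞) ^ (1 / n : ℝ)) ^ (n : ℝ) := by
            rw [← ENNReal.rpow_mul, one_div, inv_mul_cancel₀ hn0, ENNReal.rpow_one]
        _ ≤ (r : ℝ≥0∞) ^ (n : ℝ) := ENNReal.rpow_le_rpow h1 (Nat.cast_nonneg n)
        _ = _ := ENNReal.rpow_natCast _ _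
    have h3 : ‖N ^ n‖₊ ≤ r ^ n := by exact_mod_cast h2
    exact_mod_cast h3
  refine ⟨1 + ∑ k ∈ Finset.range (max n₀ 1), ‖N ^ k‖ / (r : ℝ) ^ k, r, by positivity, hr0, hr1',
    fun n => ?_⟩
  by_cases hn : max n₀ 1 ≤ n
  · refine (key n hn).trans (le_mul_of_one_le_left (by positivity) ?_)
    exact le_add_of_nonneg_right (Finset.sum_nonneg fun k _ => by positivity)
  · have h4 : ‖N ^ n‖ / (r : ℝ) ^ n ≤ ∑ k ∈ Finset.range (max n₀ 1), ‖N ^ k‖ / (r : ℝ) ^ k :=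
      Finset.single_le_sum (f := fun k => ‖N ^ k‖ / (r : ℝ) ^ k) (fun k _ => by positivity)
        (Finset.mem_range.2 (not_le.1 hn))
    rw [← div_le_iff₀ (by positivity)]
    linarith

theorem eq_zero_of_map_eq_self {𝕜 F : Type*} [RCLike 𝕜] [NormedAddCommGroup F]
    [NormedSpace 𝕜 F] {N : F →L[𝕜] F} {C θ : ℝ} (hθ : 0 < θ) (hθ1 : θ < 1)
    (hN : ∀ n : ℕ, ‖N ^ n‖ ≤ C * θ ^ n) {e : F} (he : N e = e) : e = 0 := by
  have hpow : ∀ n : ℕ, (N ^ n) e = e := by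
    intro n
    induction n with
    | zero => simp
    | succ n ih => rw [pow_succ, mul_apply_eq_comp, he, ih]
  have hlim : Tendsto (fun n : ℕ => C * θ ^ n * ‖e‖) atTop (𝓝 0) := by
    simpa using ((tendsto_pow_atTop_nhds_zero_of_lt_one hθ.le hθ1).const_mul C).mul_const ‖e‖
  have : ‖e‖ ≤ 0 := ge_of_tendsto' hlim fun n => by
    calc ‖e‖ = ‖(N ^ n) e‖ := by rw [hpow]
      _ ≤ ‖N ^ n‖ * ‖e‖ := ContinuousLinearMap.le_opNorm _ _
      _ ≤ _ := by gcongr; exact hN n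
  simpa using this

/-! ### The transfer operator on the algebra -/

theorem coeFn_map_add {Ω 𝕜 F : Type*} [RCLike 𝕜] [MeasurableSpace Ω] {μ : Measure Ω}
    [NormedCommRing F] [NormedAlgebra 𝕜 F]
    (ι : F →ₗ[𝕜] (Ω →ₘ[μ] 𝕜)) (g h : F) :
    ι (g + h) =ᵐ[μ] fun ω => ι g ω + ι h ω := by
  rw [map_add]
  exact AEEqFun.coeFn_add _ _

theorem coeFn_map_smul {Ω 𝕜 F : Type*} [RCLike 𝕜] [MeasurableSpace Ω] {μ : Measure Ω}
    [NormedCommRing F] [NormedAlgebra 𝕜 F]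
    (ι : F →ₗ[𝕜] (Ω →ₘ[μ] 𝕜)) (a : 𝕜) (g : F) :
    ι (a • g) =ᵐ[μ] fun ω => a * ι g ω := by
  rw [map_smul]
  exact AEEqFun.coeFn_smul a (ι g)

section Transfer

variable {Ω 𝕜 F : Type*} [RCLike 𝕜] [MeasurableSpace Ω] {μ : Measure Ω} {T : Ω → Ω}
  [NormedCommRing F] [NormedAlgebra 𝕜 F] [CompleteSpace F] {ι : F →ₗ[𝕜] (Ω →ₘ[μ] 𝕜)}

theorem PropertyC.ae_norm_le (hC : PropertyC μ T ι) (g : F) : ∀ᵐ ω ∂μ, ‖ι g ω‖ ≤ ‖g‖ := by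
  have h := hC.sup_le_norm g
  rw [eLpNorm_exponent_top] at h
  filter_upwards [ae_le_eLpNormEssSup (f := ι g) (μ := μ)] with ω hω
  have := hω.trans h
  rwa [← ofReal_norm, ENNReal.ofReal_le_ofReal_iff (norm_nonneg _)] at this

theorem PropertyC.integrable (hC : PropertyC μ T ι) (g : F) : Integrable (ι g) μ := by
  have := hC.prob
  exact Integrable.of_bound (ι g).aestronglyMeasurable ‖g‖ (hC.ae_norm_le g)

theorem PropertyC.coeFn_one (hC : PropertyC μ T ι) : ι 1 =ᵐ[μ] fun _ => (1 : 𝕜) := by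
  rw [hC.map_one]
  exact AEEqFun.coeFn_one

theorem PropertyC.coeFn_mul (hC : PropertyC μ T ι) (g h : F) :
    ι (g * h) =ᵐ[μ] fun ω => ι g ω * ι h ω := by
  rw [hC.map_mul]
  exact AEEqFun.coeFn_mul _ _

/-- The integral as a linear functional on the algebra. -/
noncomputable def PropertyC.integralₗ (hC : PropertyC μ T ι) : F →ₗ[𝕜] 𝕜 where
  toFun g := ∫ ω, ι g ω ∂μ
  map_add' g h := by
    rw [integral_congr_ae (coeFn_map_add ι g h)]
    exact integral_add (hC.integrable g) (hC.integrable h)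
  map_smul' a g := by
    rw [integral_congr_ae (coeFn_map_smul ι a g)]
    exact integral_const_mul _ _

theorem PropertyC.norm_integralₗ_le (hC : PropertyC μ T ι) (g : F) :
    ‖hC.integralₗ g‖ ≤ ‖g‖ := by
  have := hC.prob
  change ‖∫ ω, ι g ω ∂μ‖ ≤ ‖g‖
  simpa using norm_integral_le_of_norm_le_const (hC.ae_norm_le g)

theorem PropertyC.integralₗ_one (hC : PropertyC μ T ι) : hC.integralₗ 1 = 1 := by
  have := hC.prob
  change ∫ ω, ι 1 ω ∂μ = 1
  rw [integral_congr_ae hC.coeFn_one]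
  simp

theorem PropertyC.integral_comp (hC : PropertyC μ T ι) {h : Ω → 𝕜} (hh : Measurable h) :
    ∫ ω, h (T ω) ∂μ = ∫ ω, h ω ∂μ := by
  conv_rhs => rw [← hC.invariant.map_eq]
  rw [integral_map hC.invariant.measurable.aemeasurable hh.aestronglyMeasurable]

theorem PropertyC.integralₗ_transfer (hC : PropertyC μ T ι) {g g' : F}
    (h : IsTransferImage μ T (ι g) (ι g')) : hC.integralₗ g' = hC.integralₗ g := by
  have := h.2.2 (fun _ => 1) measurable_const ⟨1, fun _ => by simp⟩
  change ∫ ω, ι g' ω ∂μ = ∫ ω, ι g ω ∂μ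
  simpa using this

/-- The spectral gap in normal form: the leading eigenvalue is `1`, its eigenprojection is
integration, and the powers of the remainder decay exponentially. -/
theorem PropertyC.exists_transfer_eq (hC : PropertyC μ T ι) :
    ∃ (U N : F →L[𝕜] F) (C θ : ℝ), (∀ g, IsTransferImage μ T (ι g) (ι (U g))) ∧
      0 < C ∧ 0 < θ ∧ θ < 1 ∧ (∀ n : ℕ, ‖N ^ n‖ ≤ C * θ ^ n) ∧ N 1 = 0 ∧
      ∀ g, U g = hC.integralₗ g • 1 + N g := by
  have := hC.prob
  obtain ⟨U, hU, c, P, N, hUcPN, hPP, hrank, hrad, hPN, hNP⟩ := hC.transfer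
  have hUapp : ∀ g, U g = c • P g + N g := fun g => by
    rw [hUcPN]; simp
  have hPPapp : ∀ g, P (P g) = P g := fun g => by
    rw [← mul_apply_eq_comp, hPP]
  have hPNapp : ∀ g, P (N g) = 0 := fun g => by
    rw [← mul_apply_eq_comp, hPN]; simp
  have hNPapp : ∀ g, N (P g) = 0 := fun g => by
    rw [← mul_apply_eq_comp, hNP]; simp
  have hU1 : U 1 = 1 := by
    apply hC.injective
    apply AEEqFun.ext
    refine IsTransferImage.unique (T := T) (hU 1) ⟨hC.integrable 1, hC.integrable 1, ?_⟩
    intro h hh _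
    have h1 : ∀ h' : Ω → 𝕜, ∫ ω, ι 1 ω * h' ω ∂μ = ∫ ω, h' ω ∂μ := fun h' =>
      integral_congr_ae (by filter_upwards [hC.coeFn_one] with ω hω; simp [hω])
    rw [h1, h1, hC.integral_comp hh]
  have h1ne : (1 : F) ≠ 0 := by
    intro h0
    have := hC.integralₗ_one
    rw [h0, map_zero] at this
    exact zero_ne_one this
  have hint : ∀ (n : ℕ) (g : F) (h : Ω → 𝕜), Measurable h → (∃ C : ℝ, ∀ ω, ‖h ω‖ ≤ C) →
      ∫ ω, ι ((U ^ n) g) ω * h ω ∂μ = ∫ ω, ι g ω * h (T^[n] ω) ∂μ := by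
    intro n
    induction n with
    | zero => intro g h _ _; simp
    | succ n ih =>
      rintro g h hh ⟨B, hB⟩
      rw [pow_succ', mul_apply_eq_comp, (hU _).2.2 h hh ⟨B, hB⟩,
        ih g (fun ω => h (T ω)) (hh.comp hC.invariant.measurable) ⟨B, fun ω => hB _⟩]
      simp only [Function.iterate_succ_apply']
  -- An eigenvalue of modulus larger than one would contradict the duality with `L^∞`.
  have hc1 : ‖c‖ ≤ 1 := by
    by_contra! hc
    obtain ⟨⟨v, hv⟩, hv0⟩ : ∃ v : LinearMap.range (P : F →ₗ[𝕜] F), v ≠ 0 := by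
      by_contra! hcon
      have : Subsingleton (LinearMap.range (P : F →ₗ[𝕜] F)) :=
        ⟨fun a b => by rw [hcon a, hcon b]⟩
      rw [Module.finrank_zero_of_subsingleton] at hrank
      exact zero_ne_one hrank
    obtain ⟨w, hw⟩ := hv
    have hPv : P v = v := by rw [← hw]; exact hPPapp w
    have hUv : ∀ n : ℕ, (U ^ n) v = c ^ n • v := by
      intro n
      induction n with
      | zero => simp
      | succ n ih =>
        rw [pow_succ', mul_apply_eq_comp, ih, map_smul, hUapp, hPv]
        have : N v = 0 := by rw [← hPv]; exact hNPapp v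
        rw [this, add_zero, smul_smul, pow_succ]
    apply hv0
    rw [Subtype.ext_iff]
    apply hC.injective
    rw [ZeroMemClass.coe_zero, map_zero]
    apply AEEqFun.ext
    refine IsTransferImage.unique (T := T) (f := fun _ => (0 : 𝕜))
      ⟨integrable_zero _ _ _, hC.integrable v, ?_⟩
      ⟨integrable_zero _ _ _, (integrable_zero _ _ μ).congr AEEqFun.coeFn_zero.symm, ?_⟩
    · rintro h hh ⟨B, hB⟩
      have hB0 : 0 ≤ B := by
        obtain ⟨ω⟩ := nonempty_of_isProbabilityMeasure μ
        exact (norm_nonneg _).trans (hB ω)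
      have hbound : ∀ n : ℕ, ‖∫ ω, ι v ω * h ω ∂μ‖ ≤ (‖c‖⁻¹) ^ n * (‖v‖ * B) := by
        intro n
        have h1 := hint n v h hh ⟨B, hB⟩
        have h2 : ∫ ω, ι ((U ^ n) v) ω * h ω ∂μ = c ^ n * ∫ ω, ι v ω * h ω ∂μ := by
          rw [← integral_const_mul, hUv n]
          refine integral_congr_ae ?_
          filter_upwards [coeFn_map_smul ι (c ^ n) v] with ω hω
          rw [hω, mul_assoc]
        have h3 : ‖∫ ω, ι v ω * h (T^[n] ω) ∂μ‖ ≤ ‖v‖ * B := by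
          have := norm_integral_le_of_norm_le_const (μ := μ) (C := ‖v‖ * B)
            (f := fun ω => ι v ω * h (T^[n] ω)) (by
              filter_upwards [hC.ae_norm_le v] with ω hω
              rw [norm_mul]
              exact mul_le_mul hω (hB _) (norm_nonneg _) (norm_nonneg _))
          simpa using this
        rw [← h1, h2, norm_mul, norm_pow] at h3
        rw [inv_pow, inv_mul_eq_div, le_div_iff₀ (by positivity)]
        linarith
      have hlim : Tendsto (fun n : ℕ => (‖c‖⁻¹) ^ n * (‖v‖ * B)) atTop (𝓝 0) := by
        simpa using (tendsto_pow_atTop_nhds_zero_of_lt_one (by positivity)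
          (inv_lt_one_of_one_lt₀ hc)).mul_const (‖v‖ * B)
      have := ge_of_tendsto' hlim hbound
      simpa using this
    · intro h _ _
      simp only [zero_mul, integral_zero]
      rw [integral_congr_ae (g := fun _ => (0 : 𝕜))]
      · simp
      · filter_upwards [AEEqFun.coeFn_zero (α := Ω) (β := 𝕜) (μ := μ)] with ω hω
        rw [hω]; simp
  have hrad1 : opSpectralRadius N < 1 := by
    refine hrad.trans_le ?_
    have : ‖c‖₊ ≤ 1 := by exact_mod_cast hc1
    exact_mod_cast this
  obtain ⟨C, θ, hC0, hθ0, hθ1, hpow⟩ := exists_norm_pow_le_of_opSpectralRadius_lt_one hrad1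
  have hfix : ∀ e, N e = e → e = 0 := fun e => eq_zero_of_map_eq_self hθ0 hθ1 hpow
  have hP1ne : P 1 ≠ 0 := by
    intro h0
    apply h1ne
    apply hfix
    have := hUapp 1
    rw [hU1, h0, smul_zero, zero_add] at this
    exact this.symm
  have hc : c = 1 := by
    have h1 : P 1 = c • P 1 := by
      conv_lhs => rw [← hU1, hUapp, map_add, map_smul, hPPapp, hPNapp, add_zero]
    have h2 : (c - 1) • P 1 = 0 := by rw [sub_smul, one_smul, ← h1, sub_self]
    exact sub_eq_zero.1 ((smul_eq_zero.1 h2).resolve_right hP1ne)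
  subst hc
  simp only [one_smul] at hUapp
  have hP1 : P 1 = 1 := by
    have h1 : N 1 = 1 - P 1 := by rw [eq_sub_iff_add_eq', ← hUapp, hU1]
    have h2 : 1 - P 1 = 0 := hfix _ (by rw [map_sub, hNPapp, sub_zero, h1])
    exact (sub_eq_zero.1 h2).symm
  have hN1 : N 1 = 0 := by rw [← hP1]; exact hNPapp 1
  have hIU : ∀ g, hC.integralₗ (U g) = hC.integralₗ g := fun g => hC.integralₗ_transfer (hU g)
  have hP : ∀ g, P g = hC.integralₗ g • 1 := by
    intro g
    have h1 : ∃ a : 𝕜, a • (1 : F) = P g := by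
      have hne : (⟨1, 1, hP1⟩ : LinearMap.range (P : F →ₗ[𝕜] F)) ≠ 0 := by
        rw [Ne, Subtype.ext_iff]; exact h1ne
      obtain ⟨a, ha⟩ := (finrank_eq_one_iff_of_nonzero' _ hne).1 hrank ⟨P g, g, rfl⟩
      exact ⟨a, congrArg Subtype.val ha⟩
    obtain ⟨a, ha⟩ := h1
    have h2 : ∀ n : ℕ, P ((N ^ n) (g - P g)) = 0 ∧
        hC.integralₗ ((N ^ n) (g - P g)) = hC.integralₗ (g - P g) := by
      intro n
      induction n with
      | zero => exact ⟨by simp [hPPapp], by simp⟩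
      | succ n ih =>
        rw [pow_succ', mul_apply_eq_comp]
        refine ⟨hPNapp _, ?_⟩
        have := hUapp ((N ^ n) (g - P g))
        rw [ih.1, zero_add] at this
        rw [← this, hIU, ih.2]
    have hlim : Tendsto (fun n : ℕ => C * θ ^ n * ‖g - P g‖) atTop (𝓝 0) := by
      simpa using ((tendsto_pow_atTop_nhds_zero_of_lt_one hθ0.le hθ1).const_mul C).mul_const
        ‖g - P g‖
    have h3 : ‖hC.integralₗ (g - P g)‖ ≤ 0 := ge_of_tendsto' hlim fun n => by
      rw [← (h2 n).2]
      refine (hC.norm_integralₗ_le _).trans ((ContinuousLinearMap.le_opNorm _ _).trans ?_)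
      gcongr
      exact hpow n
    have h4 : hC.integralₗ (g - P g) = 0 := by simpa using h3
    rw [map_sub, ← ha, map_smul, hC.integralₗ_one, smul_eq_mul, mul_one, sub_eq_zero] at h4
    rw [← ha, h4]
  exact ⟨U, N, C, θ, hU, hC0, hθ0, hθ1, hpow, hN1, fun g => by rw [hUapp, hP]⟩

end Transfer

/-! ### Laplace transforms of Birkhoff sums -/

section Laplace

variable {Ω 𝕜 F : Type*} [RCLike 𝕜] [MeasurableSpace Ω] {μ : Measure Ω} {T : Ω → Ω}
  [NormedCommRing F] [NormedAlgebra 𝕜 F] [CompleteSpace F] {ι : F →ₗ[𝕜] (Ω →ₘ[μ] 𝕜)}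

/-- Iterating `g ↦ U (W g)` for the transfer operator `U` and a multiplier `W`, starting from the
constant `1`, computes integrals of the products of `W` along orbits. -/
theorem PropertyC.integral_iterate_mul (hC : PropertyC μ T ι) {U : F →L[𝕜] F}
    (hU : ∀ g, IsTransferImage μ T (ι g) (ι (U g))) {W : F} {w : Ω → ℝ} (hw : Measurable w)
    {B : ℝ} (hB : ∀ ω, |w ω| ≤ B) (hW : ι W =ᵐ[μ] fun ω => ((w ω : ℝ) : 𝕜)) (n : ℕ)
    {h : Ω → 𝕜} (hh : Measurable h) (hb : ∃ B' : ℝ, ∀ ω, ‖h ω‖ ≤ B') :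
    ∫ ω, ι ((fun g => U (W * g))^[n] 1) ω * h ω ∂μ
      = ∫ ω, ((∏ i ∈ Finset.range n, w (T^[i] ω) : ℝ) : 𝕜) * h (T^[n] ω) ∂μ := by
  induction n generalizing h with
  | zero =>
    refine integral_congr_ae ?_
    filter_upwards [hC.coeFn_one] with ω hω
    simp [hω]
  | succ n ih =>
    obtain ⟨B', hB'⟩ := hb
    rw [Function.iterate_succ_apply', (hU _).2.2 h hh ⟨B', hB'⟩]
    have h1 : ∫ ω, ι (W * (fun g => U (W * g))^[n] 1) ω * h (T ω) ∂μ
        = ∫ ω, ι ((fun g => U (W * g))^[n] 1) ω * (((w ω : ℝ) : 𝕜) * h (T ω)) ∂μ := by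
      refine integral_congr_ae ?_
      filter_upwards [hC.coeFn_mul W ((fun g => U (W * g))^[n] 1), hW] with ω h1 h2
      rw [h1, h2]
      ring
    rw [h1, ih (h := fun ω => ((w ω : ℝ) : 𝕜) * h (T ω)) ((RCLike.measurable_ofReal.comp hw).mul (hh.comp hC.invariant.measurable))
      ⟨B * B', fun ω => ?_⟩]
    · refine integral_congr_ae (Eventually.of_forall fun ω => ?_)
      simp only [Finset.prod_range_succ, Function.iterate_succ_apply', RCLike.ofReal_mul]
      ring
    · rw [norm_mul, RCLike.norm_ofReal]
      exact mul_le_mul (hB ω) (hB' _) (norm_nonneg _) ((abs_nonneg _).trans (hB ω))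

/-- The exponential moment estimate. The error term is quadratic in `t` and at the same time
proportional to the mean of `φ`; the constants depend on `φ` only through the bound `K` on its
norm. -/
theorem PropertyC.exists_integral_prod_le (hC : PropertyC μ T ι) {K : ℝ} (hK : 0 < K) :
    ∃ t₀ D : ℝ, 0 < t₀ ∧ t₀ ≤ 1 / 2 ∧ 0 < D ∧
      ∀ (φ : Ω → ℝ) (v : F), Measurable φ → (∀ ω, 0 ≤ φ ω) → (∀ ω, φ ω ≤ 1) →
        (ι v =ᵐ[μ] fun ω => ((φ ω : ℝ) : 𝕜)) → ‖v‖ ≤ K → ∀ t : ℝ, |t| ≤ t₀ → ∀ n : ℕ,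
          ∫ ω, ∏ i ∈ Finset.range n, (1 + t * φ (T^[i] ω)) ∂μ
            ≤ Real.exp (n * (∫ ω, φ ω ∂μ) * (t + D * t ^ 2)) := by
  have := hC.prob
  obtain ⟨U, N, C, θ, hU, hC0, hθ0, hθ1, hpow, hN1, hUeq⟩ := hC.exists_transfer_eq
  -- `D` and `t₀` are chosen such that `hstep` below holds.
  set D : ℝ := 2 * (C * K) / (1 - θ) with hD
  have h1θ : 0 < 1 - θ := by linarith
  have hCK : 0 < C * K := by positivity
  have hD0 : 0 < D := by positivity
  have hDθ : D * (1 - θ) = 2 * (C * K) := by rw [hD]; field_simp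
  set E : ℝ := C * K * D + D + D ^ 2 with hE
  have hE0 : 0 < E := by positivity
  refine ⟨min (1 / 2) (C * K / E), D, by positivity, min_le_left _ _, hD0, ?_⟩
  intro φ v hφm hφ0 hφ1 hv hvK t ht n
  have ht2 : |t| ≤ 1 / 2 := ht.trans (min_le_left _ _)
  have htE : |t| * E ≤ C * K := (le_div_iff₀ hE0).1 (ht.trans (min_le_right _ _))
  have ht0 : 0 ≤ |t| := abs_nonneg t
  have hstep : θ * (D + C * K * (1 + D * |t|)) ≤ D * (1 - |t| - D * t ^ 2) := by
    rw [← sq_abs t]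
    have h1 : θ * (C * K * (1 + D * |t|)) ≤ 1 * (C * K * (1 + D * |t|)) := by gcongr
    have h2 : |t| * (D ^ 2 * |t|) ≤ |t| * (D ^ 2 * 1) := by gcongr; linarith
    nlinarith
  have hφb : ∀ ω, |φ ω| ≤ 1 := fun ω => abs_le.2 ⟨by linarith [hφ0 ω], hφ1 ω⟩
  have hφi : Integrable φ μ := Integrable.of_bound hφm.aestronglyMeasurable 1
    (Eventually.of_forall hφb)
  set m : ℝ := ∫ ω, φ ω ∂μ with hm
  have hm0 : 0 ≤ m := integral_nonneg hφ0
  have hm1 : m ≤ 1 := by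
    have := integral_mono hφi (integrable_const (1 : ℝ)) hφ1
    simpa using this
  set w : Ω → ℝ := fun ω => 1 + t * φ ω with hw
  have hwm : Measurable w := measurable_const.add (hφm.const_mul t)
  have htφ : ∀ ω, |t * φ ω| ≤ 1 / 2 := fun ω => by
    rw [abs_mul]
    calc |t| * |φ ω| ≤ 1 / 2 * 1 := by gcongr; exact hφb ω
      _ = 1 / 2 := by norm_num
  have hwpos : ∀ ω, 0 ≤ w ω := fun ω => by
    have := (abs_le.1 (htφ ω)).1
    simp only [hw]; linarith
  have hwB : ∀ ω, |w ω| ≤ 2 := fun ω => by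
    rw [abs_of_nonneg (hwpos ω)]
    have := (abs_le.1 (htφ ω)).2
    simp only [hw]; linarith
  set W : F := 1 + (t : 𝕜) • v with hWdef
  have hW : ι W =ᵐ[μ] fun ω => ((w ω : ℝ) : 𝕜) := by
    filter_upwards [coeFn_map_add ι 1 ((t : 𝕜) • v), coeFn_map_smul ι (t : 𝕜) v, hv,
      hC.coeFn_one] with ω h1 h2 h3 h4
    rw [h1, h2, h3, h4]
    simp [hw]
  set A : ℕ → ℝ := fun n => ∫ ω, ∏ i ∈ Finset.range n, w (T^[i] ω) ∂μ with hA
  have hA0 : ∀ n, 0 ≤ A n := fun n =>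
    integral_nonneg fun ω => Finset.prod_nonneg fun i _ => hwpos _
  set g : ℕ → F := fun n => (fun g => U (W * g))^[n] 1 with hg
  have hgA : ∀ n, hC.integralₗ (g n) = ((A n : ℝ) : 𝕜) := by
    intro n
    have := hC.integral_iterate_mul hU hwm hwB hW n (h := fun _ => 1) measurable_const
      ⟨1, fun _ => by simp⟩
    simp only [mul_one] at this
    rw [integral_ofReal] at this
    exact this
  have hgsucc : ∀ n, g (n + 1) = U (W * g n) := fun n => by
    simp only [hg, Function.iterate_succ_apply']
  have hIv : hC.integralₗ v = ((m : ℝ) : 𝕜) := by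
    change ∫ ω, ι v ω ∂μ = _
    rw [integral_congr_ae hv, integral_ofReal]
  have hIvh : ∀ h : F, ‖hC.integralₗ (v * h)‖ ≤ m * ‖h‖ := by
    intro h
    change ‖∫ ω, ι (v * h) ω ∂μ‖ ≤ _
    rw [hm, ← integral_mul_const]
    refine norm_integral_le_of_norm_le (hφi.mul_const _) ?_
    filter_upwards [hC.coeFn_mul v h, hv, hC.ae_norm_le h] with ω h1 h2 h3
    rw [h1, h2, norm_mul, RCLike.norm_ofReal, abs_of_nonneg (hφ0 ω)]
    exact mul_le_mul_of_nonneg_left h3 (hφ0 ω)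
  set h : ℕ → F := fun n => g n - ((A n : ℝ) : 𝕜) • 1 with hh
  have hgh : ∀ n, g n = ((A n : ℝ) : 𝕜) • 1 + h n := fun n => by simp [hh]
  have hIU : ∀ x, hC.integralₗ (U x) = hC.integralₗ x := fun x => hC.integralₗ_transfer (hU x)
  have hvg : ∀ n, v * g n = ((A n : ℝ) : 𝕜) • v + v * h n := fun n => by
    rw [hgh, mul_add, mul_smul_comm, mul_one]
  have hWg : ∀ n, W * g n = g n + (t : 𝕜) • (v * g n) := fun n => by
    rw [hWdef, add_mul, one_mul, smul_mul_assoc]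
  have hArec : ∀ n, |A (n + 1) - A n * (1 + t * m)| ≤ |t| * (m * ‖h n‖) := by
    intro n
    have h1 : ((A (n + 1) - A n * (1 + t * m) : ℝ) : 𝕜) = (t : 𝕜) * hC.integralₗ (v * h n) := by
      have h2 : ((A (n + 1) : ℝ) : 𝕜)
          = ((A n : ℝ) : 𝕜) + t * (((A n : ℝ) : 𝕜) * m + hC.integralₗ (v * h n)) := by
        rw [← hgA, hgsucc, hIU, hWg, map_add, map_smul, hvg, map_add, map_smul, hgA, hIv]
        simp only [smul_eq_mul]
      rw [RCLike.ofReal_sub, h2, RCLike.ofReal_mul, RCLike.ofReal_add, RCLike.ofReal_mul,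
        RCLike.ofReal_one]
      ring
    rw [← RCLike.norm_ofReal (K := 𝕜), h1, norm_mul, RCLike.norm_ofReal]
    exact mul_le_mul_of_nonneg_left (hIvh _) ht0
  have hhrec : ∀ n, h (n + 1) = N (h n + (t : 𝕜) • (v * g n)) := by
    intro n
    have h1 : h (n + 1) = N (W * g n) := by
      change g (n + 1) - ((A (n + 1) : ℝ) : 𝕜) • 1 = _
      rw [← hgA, hgsucc, hIU, hUeq]
      simp
    rw [h1, hWg]
    conv_lhs => rw [hgh n]
    simp only [map_add, map_smul, hN1, smul_zero, zero_add]
    rw [← hgh]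
  have hvgn : ∀ n, ‖v * g n‖ ≤ K * (A n + ‖h n‖) := by
    intro n
    rw [hvg]
    refine (norm_add_le _ _).trans ?_
    rw [norm_smul, RCLike.norm_ofReal, abs_of_nonneg (hA0 n), mul_add]
    have h1 : A n * ‖v‖ ≤ A n * K := mul_le_mul_of_nonneg_left hvK (hA0 n)
    have h2 : ‖v * h n‖ ≤ K * ‖h n‖ :=
      (norm_mul_le _ _).trans (mul_le_mul_of_nonneg_right hvK (norm_nonneg _))
    linarith
  -- Carrying all `N ^ j (h n)` along replaces an adapted norm for `N`.
  have key : ∀ n, ∀ j : ℕ, ‖(N ^ j) (h n)‖ ≤ θ ^ j * (D * |t| * A n) := by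
    intro n
    induction n with
    | zero =>
      intro j
      have : h 0 = 0 := by simp [hh, hg, hA]
      rw [this, map_zero, norm_zero]
      have := hA0 0
      positivity
    | succ n ih =>
      intro j
      have hn := hA0 n
      have hh0 : ‖h n‖ ≤ D * |t| * A n := by simpa using ih 0
      have hlow : A n * (1 - |t| - D * t ^ 2) ≤ A (n + 1) := by
        have h1 := (abs_le.1 (hArec n)).1
        have h2 : |t| * (m * ‖h n‖) ≤ |t| * (1 * (D * |t| * A n)) := by gcongr
        have h3 : -|t| ≤ t * m := by
          have := neg_abs_le (t * m)
          rw [abs_mul, abs_of_nonneg hm0] at this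
          have h4 : |t| * m ≤ |t| * 1 := by gcongr
          linarith
        have h5 : A n * (-|t|) ≤ A n * (t * m) := mul_le_mul_of_nonneg_left h3 hn
        rw [← sq_abs t]
        nlinarith
      have h1 : ‖(N ^ (j + 1)) ((t : 𝕜) • (v * g n))‖
          ≤ C * θ ^ (j + 1) * (|t| * (K * (A n + D * |t| * A n))) := by
        refine (ContinuousLinearMap.le_opNorm _ _).trans ?_
        rw [norm_smul, RCLike.norm_ofReal]
        have h2 : ‖v * g n‖ ≤ K * (A n + D * |t| * A n) := (hvgn n).trans (by gcongr)
        exact mul_le_mul (hpow _) (mul_le_mul_of_nonneg_left h2 ht0) (by positivity)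
          (by positivity)
      calc ‖(N ^ j) (h (n + 1))‖
          = ‖(N ^ (j + 1)) (h n) + (N ^ (j + 1)) ((t : 𝕜) • (v * g n))‖ := by
            rw [hhrec, ← map_add, pow_succ, mul_apply_eq_comp]
        _ ≤ θ ^ (j + 1) * (D * |t| * A n)
            + C * θ ^ (j + 1) * (|t| * (K * (A n + D * |t| * A n))) :=
            (norm_add_le _ _).trans (add_le_add (ih _) h1)
        _ = θ ^ j * (|t| * (A n * (θ * (D + C * K * (1 + D * |t|))))) := by ring
        _ ≤ θ ^ j * (|t| * (A n * (D * (1 - |t| - D * t ^ 2)))) := by gcongr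
        _ = θ ^ j * (D * |t| * (A n * (1 - |t| - D * t ^ 2))) := by ring
        _ ≤ θ ^ j * (D * |t| * A (n + 1)) := by gcongr
  have hup : ∀ n, A (n + 1) ≤ A n * Real.exp (m * (t + D * t ^ 2)) := by
    intro n
    have hn := hA0 n
    have h0 : ‖h n‖ ≤ D * |t| * A n := by simpa using key n 0
    have h1 := (abs_le.1 (hArec n)).2
    have h2 : |t| * (m * ‖h n‖) ≤ |t| * (m * (D * |t| * A n)) := by gcongr
    have h3 : A n * (m * (t + D * t ^ 2) + 1) ≤ A n * Real.exp (m * (t + D * t ^ 2)) :=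
      mul_le_mul_of_nonneg_left (Real.add_one_le_exp _) hn
    rw [← sq_abs t] at h3 ⊢
    nlinarith
  have hfinal : ∀ n : ℕ, A n ≤ Real.exp (n * m * (t + D * t ^ 2)) := by
    intro n
    induction n with
    | zero => simp [hA]
    | succ n ih =>
      refine (hup n).trans ((mul_le_mul_of_nonneg_right ih (Real.exp_pos _).le).trans ?_)
      rw [← Real.exp_add]
      apply le_of_eq
      congr 1
      push_cast
      ring
  exact hfinal n

/-! ### Large deviations -/

theorem exp_le_one_add_mul {t x : ℝ} (ht : |t| ≤ 1 / 2) (hx0 : 0 ≤ x) (hx1 : x ≤ 1) :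
    Real.exp ((t - 2 * t ^ 2) * x) ≤ 1 + t * x := by
  have hb : |t * x| ≤ 1 / 2 := by
    rw [abs_mul, abs_of_nonneg hx0]
    calc |t| * x ≤ 1 / 2 * 1 := by gcongr
      _ = 1 / 2 := by norm_num
  have hl := (abs_le.1 hb).1
  have hpos : 0 < 1 + t * x := by linarith
  rw [← Real.le_log_iff_exp_le hpos]
  refine le_trans ?_ (Real.one_sub_inv_le_log_of_pos hpos)
  have h1 : 1 - (1 + t * x)⁻¹ = t * x - (t * x) ^ 2 / (1 + t * x) := by
    field_simp
    ring
  have h2 : (t * x) ^ 2 / (1 + t * x) ≤ 2 * t ^ 2 * x := by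
    rw [div_le_iff₀ hpos]
    have h3 : x * x ≤ x * 1 := by gcongr
    have h4 : t ^ 2 * (x * x) ≤ t ^ 2 * (x * 1) := by gcongr
    have h5 : 0 ≤ 2 * t ^ 2 * x * (1 / 2 + t * x) :=
      mul_nonneg (by positivity) (by linarith)
    nlinarith
  rw [h1]
  linarith

/-- Large deviations of Birkhoff sums at the scale of their mean, with an exponent proportional
to the mean. -/
theorem PropertyC.exists_deviation_le (hC : PropertyC μ T ι) {K : ℝ} (hK : 0 < K) {ε : ℝ}
    (hε : 0 < ε) (hε1 : ε < 1) :
    ∃ c : ℝ, 0 < c ∧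
      ∀ (φ : Ω → ℝ) (v : F), Measurable φ → (∀ ω, 0 ≤ φ ω) → (∀ ω, φ ω ≤ 1) →
        (ι v =ᵐ[μ] fun ω => ((φ ω : ℝ) : 𝕜)) → ‖v‖ ≤ K → ∀ n : ℕ,
          μ.real {ω | (1 + ε) * (n * ∫ ω, φ ω ∂μ) ≤ birkhoffSum T φ n ω}
              ≤ Real.exp (-(c * (n * ∫ ω, φ ω ∂μ))) ∧
          μ.real {ω | birkhoffSum T φ n ω ≤ (1 - ε) * (n * ∫ ω, φ ω ∂μ)}
              ≤ Real.exp (-(c * (n * ∫ ω, φ ω ∂μ))) := by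
  have := hC.prob
  obtain ⟨t₀, D, ht0, ht2, hD, hmain⟩ := hC.exists_integral_prod_le (T := T) hK
  set s : ℝ := min t₀ (ε / (2 * (4 + D))) with hs
  have hs0 : 0 < s := by positivity
  have hst : s ≤ t₀ := min_le_left _ _
  have hs2 : s ≤ 1 / 2 := hst.trans ht2
  have hsε : s * (4 + D) ≤ ε / 2 := by
    have h1 : s ≤ ε / (2 * (4 + D)) := min_le_right _ _
    rw [le_div_iff₀ (by positivity)] at h1
    linarith
  have hsq : s * (s * (4 + D)) ≤ s * (ε / 2) := by gcongr
  refine ⟨s * ε / 2, by positivity, ?_⟩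
  intro φ v hφm hφ0 hφ1 hv hvK n
  set M : ℝ := n * ∫ ω, φ ω ∂μ with hM
  have hM0 : 0 ≤ M := mul_nonneg (Nat.cast_nonneg n) (integral_nonneg hφ0)
  -- Markov's inequality for the product.
  have markov : ∀ (t a : ℝ) (S : Set Ω), |t| ≤ t₀ →
      (∀ ω ∈ S, a ≤ (t - 2 * t ^ 2) * birkhoffSum T φ n ω) →
      μ.real S ≤ Real.exp (M * (t + D * t ^ 2) - a) := by
    intro t a S ht hS
    have ht' : |t| ≤ 1 / 2 := ht.trans ht2
    have hprod : ∀ ω, Real.exp ((t - 2 * t ^ 2) * birkhoffSum T φ n ω)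
        ≤ ∏ i ∈ Finset.range n, (1 + t * φ (T^[i] ω)) := by
      intro ω
      rw [birkhoffSum, Finset.mul_sum, Real.exp_sum]
      exact Finset.prod_le_prod (fun i _ => (Real.exp_pos _).le)
        fun i _ => exp_le_one_add_mul ht' (hφ0 _) (hφ1 _)
    have hpm : Measurable fun ω => ∏ i ∈ Finset.range n, (1 + t * φ (T^[i] ω)) :=
      Finset.measurable_prod _ fun i _ => measurable_const.add
        ((hφm.comp (hC.invariant.measurable.iterate i)).const_mul t)
    have hpi : Integrable (fun ω => ∏ i ∈ Finset.range n, (1 + t * φ (T^[i] ω))) μ := by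
      refine Integrable.of_bound hpm.aestronglyMeasurable (2 ^ n) (Eventually.of_forall fun ω => ?_)
      rw [norm_prod]
      calc ∏ i ∈ Finset.range n, ‖1 + t * φ (T^[i] ω)‖ ≤ ∏ i ∈ Finset.range n, (2 : ℝ) := by
            refine Finset.prod_le_prod (fun i _ => norm_nonneg _) fun i _ => ?_
            have h1 : |t * φ (T^[i] ω)| ≤ 1 / 2 := by
              rw [abs_mul, abs_of_nonneg (hφ0 _)]
              calc |t| * φ (T^[i] ω) ≤ 1 / 2 * 1 := mul_le_mul ht' (hφ1 _) (hφ0 _) (by norm_num)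
                _ = 1 / 2 := by norm_num
            rw [Real.norm_eq_abs]
            refine (abs_add_le _ _).trans ?_
            rw [abs_one]
            linarith
        _ = 2 ^ n := by simp
    have h1 := mul_meas_ge_le_integral_of_nonneg
      (Eventually.of_forall fun ω => (Real.exp_pos _).le.trans (hprod ω)) hpi (Real.exp a)
    have h2 : μ.real S ≤ μ.real {ω | Real.exp a ≤ ∏ i ∈ Finset.range n, (1 + t * φ (T^[i] ω))} :=
      measureReal_mono fun ω hω => (Real.exp_le_exp.2 (hS ω hω)).trans (hprod ω)
    have h3 := hmain φ v hφm hφ0 hφ1 hv hvK t ht n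
    rw [Real.exp_sub, le_div_iff₀ (Real.exp_pos a), mul_comm]
    exact (mul_le_mul_of_nonneg_left h2 (Real.exp_pos a).le).trans (h1.trans h3)
  constructor
  · refine (markov s ((s - 2 * s ^ 2) * ((1 + ε) * M)) _ (by rwa [abs_of_pos hs0])
      fun ω hω => ?_).trans (Real.exp_le_exp.2 ?_)
    · refine mul_le_mul_of_nonneg_left hω ?_
      nlinarith
    · have h1 : 0 ≤ M * (s * (ε / 2) - s * (s * (4 + D))) := mul_nonneg hM0 (by linarith)
      have h2 : 0 ≤ M * (s ^ 2 * (1 - ε)) := mul_nonneg hM0 (by nlinarith)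
      nlinarith
  · refine (markov (-s) ((-s - 2 * (-s) ^ 2) * ((1 - ε) * M)) _
      (by rwa [abs_neg, abs_of_pos hs0]) fun ω hω => ?_).trans (Real.exp_le_exp.2 ?_)
    · refine mul_le_mul_of_nonpos_left hω ?_
      nlinarith
    · have h1 : 0 ≤ M * (s * (ε / 2) - s * (s * (4 + D))) := mul_nonneg hM0 (by linarith)
      have h2 : 0 ≤ M * (s ^ 2 * (1 + ε)) := mul_nonneg hM0 (by nlinarith)
      nlinarith

end Laplace

/-! ### Truncated observables -/

section Truncation

variable {Ω : Type*} {χ : Ω → ℝ}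

theorem upperTrunc_nonneg (h0 : ∀ ω, 0 ≤ χ ω) (ℓ : ℝ) (ω : Ω) : 0 ≤ upperTrunc χ ℓ ω :=
  Set.indicator_nonneg (fun _ _ => h0 _) ω

theorem upperTrunc_le {ℓ : ℝ} (hℓ : 0 ≤ ℓ) (ω : Ω) : upperTrunc χ ℓ ω ≤ ℓ :=
  Set.indicator_apply_le' (fun h => h) fun _ => hℓ

theorem upperTrunc_mono (h0 : ∀ ω, 0 ≤ χ ω) {ℓ ℓ' : ℝ} (h : ℓ ≤ ℓ') (ω : Ω) :
    upperTrunc χ ℓ ω ≤ upperTrunc χ ℓ' ω :=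
  Set.indicator_le_indicator_of_subset (fun _ hω => le_trans hω h) h0 ω

theorem measurable_upperTrunc [MeasurableSpace Ω] (hm : Measurable χ) (ℓ : ℝ) :
    Measurable (upperTrunc χ ℓ) :=
  hm.indicator (measurableSet_le hm measurable_const)

theorem integrable_upperTrunc [MeasurableSpace Ω] {μ : Measure Ω} [IsFiniteMeasure μ]
    (hm : Measurable χ) (h0 : ∀ ω, 0 ≤ χ ω) {ℓ : ℝ} (hℓ : 0 ≤ ℓ) :
    Integrable (upperTrunc χ ℓ) μ :=
  Integrable.of_bound (measurable_upperTrunc hm ℓ).aestronglyMeasurable ℓ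
    (Eventually.of_forall fun ω => by
      rw [Real.norm_of_nonneg (upperTrunc_nonneg h0 ℓ ω)]
      exact upperTrunc_le hℓ ω)

theorem integral_upperTrunc_mono [MeasurableSpace Ω] {μ : Measure Ω} [IsFiniteMeasure μ]
    (hm : Measurable χ) (h0 : ∀ ω, 0 ≤ χ ω) {ℓ ℓ' : ℝ} (hℓ : 0 ≤ ℓ) (h : ℓ ≤ ℓ') :
    ∫ ω, upperTrunc χ ℓ ω ∂μ ≤ ∫ ω, upperTrunc χ ℓ' ω ∂μ :=
  integral_mono (integrable_upperTrunc hm h0 hℓ) (integrable_upperTrunc hm h0 (hℓ.trans h))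
    (upperTrunc_mono h0 h)

theorem mul_measureReal_le_integral_upperTrunc [MeasurableSpace Ω] {μ : Measure Ω}
    [IsFiniteMeasure μ] (hm : Measurable χ) (h0 : ∀ ω, 0 ≤ χ ω) {ℓ : ℝ} (hℓ : 0 ≤ ℓ) :
    ℓ * μ.real {ω | χ ω = ℓ} ≤ ∫ ω, upperTrunc χ ℓ ω ∂μ := by
  refine le_trans ?_
    (mul_meas_ge_le_integral_of_nonneg (Eventually.of_forall (upperTrunc_nonneg h0 ℓ))
      (integrable_upperTrunc hm h0 hℓ) ℓ)
  refine mul_le_mul_of_nonneg_left (measureReal_mono fun ω hω => ?_) hℓ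
  have hω' : χ ω = ℓ := hω
  simp [upperTrunc, hω']

theorem truncSum_mono (T : Ω → Ω) (h0 : ∀ ω, 0 ≤ χ ω) {ℓ ℓ' : ℝ} (h : ℓ ≤ ℓ') (n : ℕ) (ω : Ω) :
    truncSum T χ ℓ n ω ≤ truncSum T χ ℓ' n ω := by
  unfold truncSum birkhoffSum
  exact Finset.sum_le_sum fun _ _ => upperTrunc_mono h0 h _

theorem truncSum_mono_nat (T : Ω → Ω) (h0 : ∀ ω, 0 ≤ χ ω) (ℓ : ℝ) {n n' : ℕ} (h : n ≤ n')
    (ω : Ω) : truncSum T χ ℓ n ω ≤ truncSum T χ ℓ n' ω :=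
  Finset.sum_le_sum_of_subset_of_nonneg (Finset.range_mono h)
    fun _ _ _ => upperTrunc_nonneg h0 _ _

theorem integral_truncSum [MeasurableSpace Ω] {μ : Measure Ω} [IsFiniteMeasure μ] {T : Ω → Ω}
    (hT : MeasurePreserving T μ μ) (hm : Measurable χ) (h0 : ∀ ω, 0 ≤ χ ω) {ℓ : ℝ} (hℓ : 0 ≤ ℓ)
    (n : ℕ) : ∫ ω, truncSum T χ ℓ n ω ∂μ = n * ∫ ω, upperTrunc χ ℓ ω ∂μ := by
  have hi := integrable_upperTrunc (μ := μ) hm h0 hℓ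
  have hcomp : ∀ i : ℕ, ∫ ω, upperTrunc χ ℓ (T^[i] ω) ∂μ = ∫ ω, upperTrunc χ ℓ ω ∂μ := by
    intro i
    conv_rhs => rw [← (hT.iterate i).map_eq]
    rw [integral_map (hT.iterate i).measurable.aemeasurable
      (measurable_upperTrunc hm ℓ).aestronglyMeasurable]
  simp only [truncSum, birkhoffSum]
  rw [integral_finsetSum (f := fun (i : ℕ) ω => upperTrunc χ ℓ (T^[i] ω)) _
    fun i _ => (hT.iterate i).integrable_comp_of_integrable hi]
  simp [hcomp]

end Truncation

/-! ### Deviations uniform in the truncation level -/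

theorem measure_biUnion_le_of_monotoneOn {Ω : Type*} [MeasurableSpace Ω] {μ : Measure Ω}
    {I : Set ℝ} (hI : BddAbove I) {s : ℝ → Set Ω} (hs : MonotoneOn s I) {b : ℝ≥0∞}
    (hb : ∀ x ∈ I, μ (s x) ≤ b) : μ (⋃ x ∈ I, s x) ≤ b := by
  rcases I.eq_empty_or_nonempty with rfl | hne
  · simp
  by_cases hmem : sSup I ∈ I
  · refine (measure_mono (Set.iUnion₂_subset fun x hx => ?_)).trans (hb _ hmem)
    exact hs hx hmem (le_csSup hI hx)
  · obtain ⟨u, hu, hlim, huI⟩ := exists_seq_tendsto_sSup hne hI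
    have hsub : (⋃ x ∈ I, s x) ⊆ ⋃ n, s (u n) := by
      refine Set.iUnion₂_subset fun x hx => ?_
      have hlt : x < sSup I :=
        lt_of_le_of_ne (le_csSup hI hx) fun h => hmem (h ▸ hx)
      obtain ⟨n, hn⟩ := (hlim.eventually (lt_mem_nhds hlt)).exists
      exact (hs hx (huI n) hn.le).trans (Set.subset_iUnion (fun n => s (u n)) n)
    have hmono : Monotone fun n => s (u n) := fun a b hab => hs (huI a) (huI b) (hu hab)
    refine (measure_mono hsub).trans ?_
    rw [hmono.measure_iUnion]
    exact iSup_le fun n => hb _ (huI n)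

theorem measure_biUnion_le_of_antitoneOn {Ω : Type*} [MeasurableSpace Ω] {μ : Measure Ω}
    {I : Set ℝ} (hI : BddBelow I) {s : ℝ → Set Ω} (hs : AntitoneOn s I) {b : ℝ≥0∞}
    (hb : ∀ x ∈ I, μ (s x) ≤ b) : μ (⋃ x ∈ I, s x) ≤ b := by
  have h := measure_biUnion_le_of_monotoneOn (μ := μ) (I := -I) hI.neg (s := fun x => s (-x))
    (b := b) (fun x hx y hy hxy => hs hy hx (neg_le_neg hxy)) fun x hx => hb _ hx
  refine (measure_mono (Set.iUnion₂_subset fun x hx => ?_)).trans h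
  have := Set.subset_biUnion_of_mem (s := -I) (u := fun x => s (-x)) (x := -x) (by simpa using hx)
  simpa using this

section Deviation

variable {Ω 𝕜 F : Type*} [RCLike 𝕜] [MeasurableSpace Ω] {μ : Measure Ω} {T : Ω → Ω}
  [NormedCommRing F] [NormedAlgebra 𝕜 F] [CompleteSpace F] {ι : F →ₗ[𝕜] (Ω →ₘ[μ] 𝕜)}
  {χ : Ω → ℝ}

theorem PropertyD.exists_truncSum_deviation_le (hD : PropertyD μ T ι χ) {ε : ℝ}
    (hε : 0 < ε) (hε1 : ε < 1) :
    ∃ c : ℝ, 0 < c ∧ ∀ ℓ : ℝ, 0 < ℓ → ∀ n : ℕ,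
      μ.real {ω | (1 + ε) * (n * ∫ ω', upperTrunc χ ℓ ω' ∂μ) ≤ truncSum T χ ℓ n ω}
          ≤ Real.exp (-(c * (n * (∫ ω, upperTrunc χ ℓ ω ∂μ) / ℓ))) ∧
      μ.real {ω | truncSum T χ ℓ n ω ≤ (1 - ε) * (n * ∫ ω', upperTrunc χ ℓ ω' ∂μ)}
          ≤ Real.exp (-(c * (n * (∫ ω, upperTrunc χ ℓ ω ∂μ) / ℓ))) := by
  obtain ⟨K, hK, hKℓ⟩ := hD.trunc_bound
  obtain ⟨c, hc, hdev⟩ := hD.propertyC.exists_deviation_le hK hε hε1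
  refine ⟨c, hc, fun ℓ hℓ n => ?_⟩
  obtain ⟨g, hg, hgK⟩ := hKℓ ℓ hℓ
  have h := hdev (fun ω => ℓ⁻¹ * upperTrunc χ ℓ ω) (((ℓ⁻¹ : ℝ) : 𝕜) • g)
    ((measurable_upperTrunc hD.measurable ℓ).const_mul _)
    (fun ω => mul_nonneg (by positivity) (upperTrunc_nonneg hD.nonneg ℓ ω))
    (fun ω => by rw [inv_mul_le_one₀ hℓ]; exact upperTrunc_le hℓ.le ω)
    (by
      filter_upwards [coeFn_map_smul ι ((ℓ⁻¹ : ℝ) : 𝕜) g, hg] with ω h1 h2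
      rw [h1, h2, RCLike.ofReal_mul])
    (by
      rw [norm_smul, RCLike.norm_ofReal, abs_of_pos (inv_pos.2 hℓ), inv_mul_le_iff₀ hℓ, mul_comm ℓ]
      exact hgK) n
  have hsum : ∀ ω, birkhoffSum T (fun ω => ℓ⁻¹ * upperTrunc χ ℓ ω) n ω
      = ℓ⁻¹ * truncSum T χ ℓ n ω := fun ω => by
    simp only [truncSum, birkhoffSum, Finset.mul_sum]
  have hmul : ∀ a b x : ℝ, a * (b * (ℓ⁻¹ * x)) = ℓ⁻¹ * (a * (b * x)) := fun a b x => by ring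
  simp only [hsum, integral_const_mul, hmul, mul_le_mul_iff_of_pos_left (inv_pos.2 hℓ)] at h
  have hexp : ∀ x : ℝ, c * (n * (ℓ⁻¹ * x)) = c * (n * x / ℓ) := fun x => by
    rw [div_eq_mul_inv]; ring
  rw [← hmul, hexp] at h
  exact h

/-- Simultaneous control of all truncation levels `ℓ ∈ [A, B]`. The levels are grouped by the size
of the mean, which is constant up to a factor close to one in each group; within a group the
deviation events are monotone in `ℓ`, so that a group costs no more than a single level, and the
bounds for the groups decay superexponentially. -/
theorem PropertyD.exists_uniform_deviation_le (hD : PropertyD μ T ι χ) {ε : ℝ}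
    (hε : 0 < ε) (hε1 : ε < 1) :
    ∃ c C : ℝ, 0 < c ∧ 0 < C ∧ ∀ (A B z : ℝ) (n : ℕ), 0 < A → 0 < z →
      0 < ∫ ω, upperTrunc χ A ω ∂μ → z ≤ n * (∫ ω, upperTrunc χ A ω ∂μ) / B →
      μ {ω | ∃ ℓ ∈ Set.Icc A B, ¬ |truncSum T χ ℓ n ω - n * ∫ ω', upperTrunc χ ℓ ω' ∂μ|
          ≤ ε * (n * ∫ ω', upperTrunc χ ℓ ω' ∂μ)}
        ≤ ENNReal.ofReal (C * Real.exp (-(c * z)) / z) := by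
  have := hD.propertyC.prob
  obtain ⟨δ, hδε⟩ : ∃ δ : ℝ, ε = 3 * δ := ⟨ε / 3, by ring⟩
  have hδ : 0 < δ := by linarith
  have hδ1 : δ < 1 / 3 := by linarith
  obtain ⟨c₀, hc₀, hdev⟩ := hD.exists_truncSum_deviation_le (T := T) hδ (by linarith)
  set r : ℝ := (1 + δ)⁻¹ with hr
  have hr0 : 0 < r := by positivity
  have hr1 : r < 1 := inv_lt_one_of_one_lt₀ (by linarith)
  have hr1' : 0 < 1 - r := by linarith
  refine ⟨c₀ / 2, 2 * (c₀ / 2)⁻¹ * (1 - r)⁻¹, by positivity, by positivity, ?_⟩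
  intro A B z n hA hz hGA hzle
  set G : ℝ → ℝ := fun ℓ => ∫ ω, upperTrunc χ ℓ ω ∂μ with hG
  set S : ℝ → Ω → ℝ := fun ℓ ω => truncSum T χ ℓ n ω with hS
  set b : ℕ → ℝ := fun m => (1 + δ) ^ m * G A with hb
  have hn0 : (0 : ℝ) ≤ n := Nat.cast_nonneg n
  have hb0 : ∀ m, 0 < b m := fun m => by have : 0 < G A := hGA; positivity
  have hbs : ∀ m, b (m + 1) = (1 + δ) * b m := fun m => by simp only [hb, pow_succ]; ring
  set I : ℕ → Set ℝ := fun m => {ℓ | ℓ ∈ Set.Icc A B ∧ b m ≤ G ℓ ∧ G ℓ < b (m + 1)} with hI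
  set up : ℕ → Set Ω := fun m => ⋃ ℓ ∈ I m, {ω | (1 + δ) * (n * b (m + 1)) ≤ S ℓ ω} with hup
  set lo : ℕ → Set Ω := fun m => ⋃ ℓ ∈ I m, {ω | S ℓ ω ≤ (1 - δ) * (n * b m)} with hlo
  have hcover : {ω | ∃ ℓ ∈ Set.Icc A B, ¬ |S ℓ ω - n * G ℓ| ≤ ε * (n * G ℓ)}
      ⊆ ⋃ m, (up m ∪ lo m) := by
    rintro ω ⟨ℓ, hℓ, hbad⟩
    have hGℓ : G A ≤ G ℓ := integral_upperTrunc_mono hD.measurable hD.nonneg hA.le hℓ.1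
    obtain ⟨m, hm1, hm2⟩ := exists_nat_pow_near (x := G ℓ / G A) (y := 1 + δ)
      ((one_le_div hGA).2 hGℓ) (by linarith)
    rw [le_div_iff₀ hGA] at hm1
    rw [div_lt_iff₀ hGA] at hm2
    have hmI : ℓ ∈ I m := ⟨hℓ, hm1, hm2⟩
    have h1 : n * b m ≤ n * G ℓ := mul_le_mul_of_nonneg_left hm1 hn0
    have h2 : n * G ℓ ≤ (1 + δ) * (n * b m) := by
      have := mul_le_mul_of_nonneg_left hm2.le hn0
      change n * G ℓ ≤ n * b (m + 1) at this
      rw [hbs] at this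
      linarith
    have h3 : 0 ≤ n * b m := mul_nonneg hn0 (hb0 m).le
    refine Set.mem_iUnion.2 ⟨m, ?_⟩
    rw [abs_le, not_and_or, not_le, not_le] at hbad
    rcases hbad with hbad | hbad
    · right
      refine Set.mem_biUnion hmI ?_
      change S ℓ ω ≤ (1 - δ) * (n * b m)
      have h4 : (1 - 3 * δ) * (n * G ℓ) ≤ (1 - 3 * δ) * ((1 + δ) * (n * b m)) :=
        mul_le_mul_of_nonneg_left h2 (by linarith)
      have h5 : 0 ≤ (δ + 3 * δ ^ 2) * (n * b m) := by positivity
      rw [hδε] at hbad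
      nlinarith
    · left
      refine Set.mem_biUnion hmI ?_
      change (1 + δ) * (n * b (m + 1)) ≤ S ℓ ω
      rw [hbs]
      have h4 : (1 + δ) ^ 2 * (n * b m) ≤ (1 + δ) ^ 2 * (n * G ℓ) := by gcongr
      have h5 : 0 ≤ (δ - δ ^ 2) * (n * G ℓ) := mul_nonneg (by nlinarith) (h3.trans h1)
      rw [hδε] at hbad
      nlinarith
  have hexp : ∀ m, ∀ ℓ ∈ I m,
      Real.exp (-(c₀ * (n * G ℓ / ℓ)))
        ≤ (c₀ / 2)⁻¹ * (Real.exp (-(c₀ / 2 * z)) / z) * r ^ m := by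
    rintro m ℓ ⟨hℓ, hm, -⟩
    have hℓ0 : 0 < ℓ := hA.trans_le hℓ.1
    have hz1 : z * (1 + δ) ^ m ≤ n * G ℓ / ℓ := by
      calc z * (1 + δ) ^ m ≤ n * G A / B * (1 + δ) ^ m := by gcongr
        _ = n * b m / B := by simp only [hb]; ring
        _ ≤ n * G ℓ / ℓ :=
          div_le_div₀ (mul_nonneg hn0 ((hb0 m).le.trans hm))
            (mul_le_mul_of_nonneg_left hm hn0) hℓ0 hℓ.2
    have hpow1 : 1 ≤ (1 + δ) ^ m := one_le_pow₀ (by linarith)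
    have hz2 : z ≤ z * (1 + δ) ^ m := le_mul_of_one_le_right hz.le hpow1
    -- Half of the exponent gives the factor `exp (-(c₀ / 2) z)`; the other half, through
    -- `exp (-x) ≤ 1 / x`, makes the bounds summable over `m` and later over `j`.
    set x : ℝ := c₀ / 2 * (z * (1 + δ) ^ m) with hx
    have hx0 : 0 < x := by positivity
    have hxinv : Real.exp (-x) ≤ x⁻¹ := by
      rw [Real.exp_neg]
      exact inv_anti₀ hx0 (by linarith [Real.add_one_le_exp x])
    calc Real.exp (-(c₀ * (n * G ℓ / ℓ))) ≤ Real.exp (-(c₀ * (z * (1 + δ) ^ m))) := by gcongr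
      _ = Real.exp (-x) * Real.exp (-x) := by rw [← Real.exp_add, hx]; congr 1; ring
      _ ≤ Real.exp (-(c₀ / 2 * z)) * x⁻¹ := by
        refine mul_le_mul (Real.exp_le_exp.2 (neg_le_neg ?_)) hxinv (Real.exp_pos _).le
          (Real.exp_pos _).le
        rw [hx]; gcongr
      _ = _ := by rw [hx, hr, mul_inv, mul_inv, inv_pow]; ring
  set a : ℝ := (c₀ / 2)⁻¹ * (Real.exp (-(c₀ / 2 * z)) / z) with ha
  have ha0 : 0 ≤ a := by positivity
  have hbound : ∀ m, μ (up m ∪ lo m) ≤ ENNReal.ofReal (2 * a * r ^ m) := by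
    intro m
    have hIbdd : I m ⊆ Set.Icc A B := fun ℓ hℓ => hℓ.1
    have h1 : μ (up m) ≤ ENNReal.ofReal (a * r ^ m) := by
      refine measure_biUnion_le_of_monotoneOn (bddAbove_Icc.mono hIbdd) ?_ ?_
      · exact fun x _ y _ hxy ω hω => le_trans hω (truncSum_mono T hD.nonneg hxy n ω)
      · intro ℓ hℓ
        rw [← ofReal_measureReal]
        refine ENNReal.ofReal_le_ofReal (le_trans ?_ (hexp m ℓ hℓ))
        refine le_trans (measureReal_mono fun ω hω => ?_) (hdev ℓ (hA.trans_le hℓ.1.1) n).1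
        have hω' : (1 + δ) * (n * b (m + 1)) ≤ S ℓ ω := hω
        refine le_trans ?_ hω'
        have := hℓ.2.2.le
        change (1 + δ) * (n * G ℓ) ≤ _
        gcongr
    have h2 : μ (lo m) ≤ ENNReal.ofReal (a * r ^ m) := by
      refine measure_biUnion_le_of_antitoneOn (bddBelow_Icc.mono hIbdd) ?_ ?_
      · exact fun x _ y _ hxy ω hω => le_trans (truncSum_mono T hD.nonneg hxy n ω) hω
      · intro ℓ hℓ
        rw [← ofReal_measureReal]
        refine ENNReal.ofReal_le_ofReal (le_trans ?_ (hexp m ℓ hℓ))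
        refine le_trans (measureReal_mono fun ω hω => ?_) (hdev ℓ (hA.trans_le hℓ.1.1) n).2
        have hω' : S ℓ ω ≤ (1 - δ) * (n * b m) := hω
        refine le_trans hω' ?_
        have := hℓ.2.1
        change _ ≤ (1 - δ) * (n * G ℓ)
        have : 0 ≤ 1 - δ := by linarith
        gcongr
    calc μ (up m ∪ lo m) ≤ ENNReal.ofReal (a * r ^ m) + ENNReal.ofReal (a * r ^ m) :=
          (measure_union_le _ _).trans (add_le_add h1 h2)
      _ = ENNReal.ofReal (2 * a * r ^ m) := by
          rw [← ENNReal.ofReal_add (by positivity) (by positivity)]; congr 1; ring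
  have hsummable : Summable fun m => 2 * a * r ^ m :=
    (summable_geometric_of_lt_one hr0.le hr1).mul_left _
  calc μ {ω | ∃ ℓ ∈ Set.Icc A B, ¬ |S ℓ ω - n * G ℓ| ≤ ε * (n * G ℓ)}
      ≤ μ (⋃ m, (up m ∪ lo m)) := measure_mono hcover
    _ ≤ ∑' m, μ (up m ∪ lo m) := measure_iUnion_le _
    _ ≤ ∑' m, ENNReal.ofReal (2 * a * r ^ m) := ENNReal.tsum_le_tsum hbound
    _ = ENNReal.ofReal (∑' m, 2 * a * r ^ m) :=
        (ENNReal.ofReal_tsum_of_nonneg (fun m => by positivity) hsummable).symm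
    _ = ENNReal.ofReal (2 * (c₀ / 2)⁻¹ * (1 - r)⁻¹ * Real.exp (-(c₀ / 2 * z)) / z) := by
        rw [tsum_mul_left, tsum_geometric_of_lt_one hr0.le hr1, ha]
        congr 1
        ring

end Deviation

/-! ### Geometric levels -/

theorem sum_range_inv_pow_le {q : ℝ} (hq0 : 0 < q) (hq1 : q < 1) (J : ℕ) :
    ∑ j ∈ Finset.range (J + 1), (q ^ j)⁻¹ ≤ (q ^ J)⁻¹ * (1 - q)⁻¹ := by
  have h1 : 0 < 1 - q := by linarith
  induction J with
  | zero =>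
    simp only [zero_add, Finset.range_one, Finset.sum_singleton, pow_zero, inv_one, one_mul]
    exact (one_le_inv₀ h1).2 (by linarith)
  | succ J ih =>
    rw [Finset.sum_range_succ]
    refine (add_le_add_left ih _).trans (le_of_eq ?_)
    rw [pow_succ]
    field_simp
    ring

section Levels

variable {Ω 𝕜 F : Type*} [RCLike 𝕜] [MeasurableSpace Ω] {μ : Measure Ω} {T : Ω → Ω}
  [NormedCommRing F] [NormedAlgebra 𝕜 F] [CompleteSpace F] {ι : F →ₗ[𝕜] (Ω →ₘ[μ] 𝕜)}
  {χ : Ω → ℝ}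

/-- The points at which, at time `n`, some truncated sum deviates from its mean by a factor
outside `[1 - ε, 1 + ε]`, among the truncation levels in those intervals `[η ^ j, η ^ (j + 1)]`,
`j ≥ 1`, for which `n * q ^ j ≥ y`. -/
def deviationSet (μ : Measure Ω) (T : Ω → Ω) (χ : Ω → ℝ) (η q ε y : ℝ) (n : ℕ) : Set Ω :=
  {ω | ∃ j : ℕ, 1 ≤ j ∧ y ≤ n * q ^ j ∧ ∃ ℓ ∈ Set.Icc (η ^ j) (η ^ (j + 1)),
    ¬ |truncSum T χ ℓ n ω - n * ∫ ω', upperTrunc χ ℓ ω' ∂μ|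
      ≤ ε * (n * ∫ ω', upperTrunc χ ℓ ω' ∂μ)}

/-- The number of admissible intervals of levels does not enter: their bounds form a geometric
progression dominated by the last one. -/
theorem PropertyD.exists_measure_deviationSet_le (hD : PropertyD μ T ι χ) {η q R : ℝ}
    (hη : 1 < η) (hq0 : 0 < q) (hq1 : q < 1) (hR : 0 < R)
    (hχ : ∀ k : ℕ, 1 ≤ k → μ.real {ω | χ ω = η ^ k} = R * q ^ k) {ε : ℝ}
    (hε : 0 < ε) (hε1 : ε < 1) :
    ∃ c C : ℝ, 0 < c ∧ 0 < C ∧ ∀ (y : ℝ) (n : ℕ), 1 ≤ y →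
      μ (deviationSet μ T χ η q ε y n) ≤ ENNReal.ofReal (C * Real.exp (-(c * y))) := by
  have := hD.propertyC.prob
  have hη0 : 0 < η := by linarith
  obtain ⟨c, C, hc, hC, hdev⟩ := hD.exists_uniform_deviation_le (T := T) hε hε1
  set κ : ℝ := R / η with hκ
  have hκ0 : 0 < κ := by positivity
  have h1q : 0 < 1 - q := by linarith
  refine ⟨c * κ, C / κ * (1 - q)⁻¹, by positivity, by positivity, fun y n hy => ?_⟩
  have hmean : ∀ j : ℕ, 1 ≤ j → R * (η * q) ^ j ≤ ∫ ω, upperTrunc χ (η ^ j) ω ∂μ := by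
    intro j hj
    have h1 := mul_measureReal_le_integral_upperTrunc (μ := μ) hD.measurable hD.nonneg
      (ℓ := η ^ j) (by positivity)
    rw [hχ j hj] at h1
    refine le_trans (le_of_eq ?_) h1
    rw [mul_pow]; ring
  set s : ℕ → Set Ω := fun j => {ω | 1 ≤ j ∧ ∃ ℓ ∈ Set.Icc (η ^ j) (η ^ (j + 1)),
    ¬ |truncSum T χ ℓ n ω - n * ∫ ω', upperTrunc χ ℓ ω' ∂μ|
      ≤ ε * (n * ∫ ω', upperTrunc χ ℓ ω' ∂μ)} with hs
  have hsj : ∀ j : ℕ, y ≤ n * q ^ j →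
      μ (s j) ≤ ENNReal.ofReal (C / κ * Real.exp (-(c * κ * y)) * (n * q ^ j)⁻¹) := by
    intro j hj
    rcases Nat.lt_or_ge j 1 with hj1 | hj1
    · have : s j = ∅ := by
        ext ω
        simp only [hs, Set.mem_ofPred_eq, Set.mem_empty_iff_false, iff_false, not_and]
        omega
      rw [this, measure_empty]
      exact bot_le
    have hx : 0 < n * q ^ j := lt_of_lt_of_le (by linarith) hj
    have hmj := hmean j hj1
    have hGpos : 0 < ∫ ω, upperTrunc χ (η ^ j) ω ∂μ := lt_of_lt_of_le (by positivity) hmj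
    have h1 := hdev (η ^ j) (η ^ (j + 1)) (κ * (n * q ^ j)) n (by positivity) (by positivity)
      hGpos (by
        rw [le_div_iff₀ (by positivity)]
        calc κ * (n * q ^ j) * η ^ (j + 1) = n * (R * (η * q) ^ j) := by
              rw [hκ, mul_pow, pow_succ]; field_simp
          _ ≤ _ := by gcongr)
    refine (measure_mono fun ω hω => ?_).trans (h1.trans (ENNReal.ofReal_le_ofReal ?_))
    · exact hω.2
    · calc C * Real.exp (-(c * (κ * (n * q ^ j)))) / (κ * (n * q ^ j))
          = C / κ * Real.exp (-(c * (κ * (n * q ^ j)))) * (n * q ^ j)⁻¹ := by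
            rw [div_eq_mul_inv, mul_inv]; ring
        _ ≤ _ := by
            have h2 : c * κ * y ≤ c * (κ * (n * q ^ j)) := by rw [mul_assoc]; gcongr
            gcongr
  -- The admissible `j` form an initial segment of `ℕ`.
  classical
  have hex : ∃ j : ℕ, (n : ℝ) * q ^ j < y := by
    have h1 : Tendsto (fun j : ℕ => (n : ℝ) * q ^ j) atTop (𝓝 0) := by
      simpa using (tendsto_pow_atTop_nhds_zero_of_lt_one hq0.le hq1).const_mul (n : ℝ)
    exact (h1.eventually (gt_mem_nhds (by linarith))).exists
  have hanti : ∀ {i j : ℕ}, i ≤ j → (n : ℝ) * q ^ j ≤ n * q ^ i := fun {i j} hij =>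
    mul_le_mul_of_nonneg_left (pow_le_pow_of_le_one hq0.le hq1.le hij) (Nat.cast_nonneg n)
  have hsub : deviationSet μ T χ η q ε y n ⊆ ⋃ j ∈ Finset.range (Nat.find hex), s j := by
    rintro ω ⟨j, hj1, hjy, hbad⟩
    refine Set.mem_biUnion (x := j) ?_ ⟨hj1, hbad⟩
    rw [Finset.mem_coe, Finset.mem_range]
    by_contra! hle
    have := hanti hle
    linarith [Nat.find_spec hex]
  refine (measure_mono hsub).trans ((measure_biUnion_finset_le _ _).trans ?_)
  rcases hJ : Nat.find hex with _ | J
  · simp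
  have hJy : y ≤ n * q ^ J := not_lt.1 (Nat.find_min hex (by omega))
  have hnq : 0 < n * q ^ J := lt_of_lt_of_le (by linarith) hJy
  have hn : (0 : ℝ) < n := pos_of_mul_pos_left hnq (by positivity)
  calc ∑ j ∈ Finset.range (J + 1), μ (s j)
      ≤ ∑ j ∈ Finset.range (J + 1),
          ENNReal.ofReal (C / κ * Real.exp (-(c * κ * y)) * (n * q ^ j)⁻¹) :=
        Finset.sum_le_sum fun j hj =>
          hsj j (hJy.trans (hanti (Nat.lt_succ_iff.1 (Finset.mem_range.1 hj))))
    _ = ENNReal.ofReal (∑ j ∈ Finset.range (J + 1),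
          C / κ * Real.exp (-(c * κ * y)) * (n * q ^ j)⁻¹) :=
        (ENNReal.ofReal_sum_of_nonneg fun j _ => by positivity).symm
    _ ≤ _ := by
        refine ENNReal.ofReal_le_ofReal ?_
        rw [← Finset.mul_sum]
        have h1 : ∑ j ∈ Finset.range (J + 1), ((n : ℝ) * q ^ j)⁻¹ ≤ (1 - q)⁻¹ := by
          simp only [mul_inv]
          rw [← Finset.mul_sum]
          calc (n : ℝ)⁻¹ * ∑ j ∈ Finset.range (J + 1), (q ^ j)⁻¹
              ≤ (n : ℝ)⁻¹ * ((q ^ J)⁻¹ * (1 - q)⁻¹) := by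
                gcongr; exact sum_range_inv_pow_le hq0 hq1 J
            _ = (n * q ^ J)⁻¹ * (1 - q)⁻¹ := by rw [mul_inv]; ring
            _ ≤ 1 * (1 - q)⁻¹ := by
                gcongr
                exact inv_le_one_of_one_le₀ (hy.trans hJy)
            _ = _ := one_mul _
        calc C / κ * Real.exp (-(c * κ * y)) * ∑ j ∈ Finset.range (J + 1), ((n : ℝ) * q ^ j)⁻¹
            ≤ C / κ * Real.exp (-(c * κ * y)) * (1 - q)⁻¹ := by gcongr
          _ = _ := by ring

/-! ### The strong law -/

theorem tendsto_atTop_of_summable_one_div {ψ : ℕ → ℝ} (hψ : ψ ∈ PsiClass) :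
    Tendsto ψ atTop atTop := by
  have h1 : Tendsto (fun n => 1 / ψ n) atTop (𝓝[>] 0) := by
    refine tendsto_nhdsWithin_iff.2 ⟨hψ.2.tendsto_atTop_zero, ?_⟩
    filter_upwards [eventually_ge_atTop 1] with n hn
    exact one_div_pos.2 (hψ.1 n hn)
  refine h1.inv_tendsto_nhdsGT_zero.congr fun n => ?_
  simp

/-- Times are compared with the grid `⌈exp (k + i / p)⌉`, `i ≤ p`, in each block
`k ≤ log n < k + 1`; a block carries boundedly many grid points, so that the bound `1 / ψ k` for
each of them is summable. -/
theorem PropertyD.ae_eventually_le_truncSum_le (hD : PropertyD μ T ι χ) {η q R : ℝ}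
    (hη : 1 < η) (hq0 : 0 < q) (hq1 : q < 1) (hR : 0 < R)
    (hχ : ∀ k : ℕ, 1 ≤ k → μ.real {ω | χ ω = η ^ k} = R * q ^ k)
    {f : ℕ → ℝ} (hf_lim : Tendsto f atTop atTop) {ψ : ℕ → ℝ} (hψ : ψ ∈ PsiClass)
    (hfψ : (fun n : ℕ => f n ^ (-Real.log q / Real.log η))
        =o[atTop] fun n : ℕ => (n : ℝ) / Real.log (ψ ⌊Real.log n⌋₊)) {p : ℕ} (hp : 2 ≤ p) :
    ∀ᵐ ω ∂μ, ∀ᶠ n : ℕ in atTop,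
      (1 - 1 / p) * (Real.exp (1 / p))⁻¹ * (n * ∫ ω', upperTrunc χ (f n) ω' ∂μ)
          ≤ truncSum T χ (f n) n ω ∧
        truncSum T χ (f n) n ω
          ≤ (1 + 1 / p) * (Real.exp (1 / p) + 1 / p) * (n * ∫ ω', upperTrunc χ (f n) ω' ∂μ) := by
  have := hD.propertyC.prob
  have hη0 : 0 < η := by linarith
  have hp2 : (2 : ℝ) ≤ p := by exact_mod_cast hp
  have hp0 : (0 : ℝ) < p := by linarith
  have hε0 : (0 : ℝ) < 1 / p := by positivity
  have hε1 : (1 : ℝ) / p < 1 := by rw [div_lt_one hp0]; linarith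
  obtain ⟨c, C, hc, hC, hmeas⟩ :=
    hD.exists_measure_deviationSet_le (T := T) hη hq0 hq1 hR hχ hε0 hε1
  -- With this threshold `exp (-c * y k) ≤ 1 / ψ k`.
  set y : ℕ → ℝ := fun k => max 1 (Real.log (ψ k) / c) with hy
  set grid : ℕ → ℕ → ℕ := fun k i => ⌈Real.exp (k + i / p)⌉₊ with hgrid
  set bad : ℕ → Set Ω := fun k =>
    ⋃ i ∈ Finset.range (p + 1), deviationSet μ T χ η q (1 / p) (y k) (grid k i) with hbad
  have hbadle : ∀ k, μ (bad k) ≤ ENNReal.ofReal ((p + 1) * (C * Real.exp (-(c * y k)))) := by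
    intro k
    refine (measure_biUnion_finset_le _ _).trans ?_
    calc ∑ i ∈ Finset.range (p + 1), μ (deviationSet μ T χ η q (1 / p) (y k) (grid k i))
        ≤ ∑ i ∈ Finset.range (p + 1), ENNReal.ofReal (C * Real.exp (-(c * y k))) :=
          Finset.sum_le_sum fun i _ => hmeas _ _ (le_max_left _ _)
      _ = _ := by
          rw [← ENNReal.ofReal_sum_of_nonneg fun i _ => by positivity]
          simp
  have hsum : Summable fun k => (p + 1) * (C * Real.exp (-(c * y k))) := by
    refine Summable.mul_left _ (Summable.mul_left _ ?_)
    refine Summable.of_norm_bounded_eventually_nat hψ.2 ?_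
    filter_upwards [eventually_ge_atTop 1] with k hk
    have hpos := hψ.1 k hk
    rw [Real.norm_of_nonneg (Real.exp_pos _).le, one_div, ← Real.exp_log (inv_pos.2 hpos),
      Real.log_inv]
    have h1 : Real.log (ψ k) / c ≤ y k := le_max_right _ _
    rw [div_le_iff₀ hc] at h1
    exact Real.exp_le_exp.2 (by linarith)
  have hfin : ∑' k, μ (bad k) ≠ ∞ := by
    refine ne_top_of_le_ne_top ?_ (ENNReal.tsum_le_tsum hbadle)
    rw [← ENNReal.ofReal_tsum_of_nonneg (fun k => by positivity) hsum]
    exact ENNReal.ofReal_ne_top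
  have hk_lim : Tendsto (fun n : ℕ => ⌊Real.log n⌋₊) atTop atTop :=
    tendsto_nat_floor_atTop.comp (Real.tendsto_log_atTop.comp tendsto_natCast_atTop_atTop)
  have hlogψ : Tendsto (fun n : ℕ => Real.log (ψ ⌊Real.log n⌋₊)) atTop atTop :=
    Real.tendsto_log_atTop.comp ((tendsto_atTop_of_summable_one_div hψ).comp hk_lim)
  filter_upwards [ae_eventually_notMem hfin] with ω hω
  filter_upwards [hk_lim.eventually hω, hf_lim.eventually_ge_atTop η,
    hlogψ.eventually_ge_atTop c, eventually_ge_atTop p, hfψ.def (show 0 < c / 4 by positivity)]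
    with n hgood hfη hlog hnp hfn
  set k : ℕ := ⌊Real.log n⌋₊ with hk
  set L : ℝ := Real.log (ψ k) with hL
  set G : ℝ := ∫ ω', upperTrunc χ (f n) ω' ∂μ with hG
  have hL0 : 0 < L := hc.trans_le hlog
  have hyk : y k = L / c := max_eq_right ((one_le_div hc).2 hlog)
  have hnp' : (p : ℝ) ≤ n := by exact_mod_cast hnp
  have hn0 : (0 : ℝ) < n := by linarith
  have hfn0 : 0 < f n := by linarith
  have hG0 : 0 ≤ G := integral_nonneg fun ω => upperTrunc_nonneg hD.nonneg _ ω
  obtain ⟨j, hj1, hj2⟩ := exists_nat_pow_near (x := f n) (y := η) (by linarith) hη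
  have hj : 1 ≤ j := by
    by_contra! hj0
    have : j = 0 := by omega
    subst this
    rw [zero_add, pow_one] at hj2
    linarith
  have hnqj : 4 * y k ≤ n * q ^ j := by
    have hα : η ^ (-Real.log q / Real.log η) = q⁻¹ := by
      rw [Real.rpow_def_of_pos hη0, mul_div_cancel₀ _ (Real.log_pos hη).ne', Real.exp_neg,
        Real.exp_log hq0]
    have hα0 : 0 ≤ -Real.log q / Real.log η :=
      div_nonneg (neg_nonneg.2 (Real.log_nonpos hq0.le hq1.le)) (Real.log_pos hη).le
    have h1 : (q ^ j)⁻¹ ≤ f n ^ (-Real.log q / Real.log η) := by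
      rw [← inv_pow, ← hα, ← Real.rpow_natCast, ← Real.rpow_mul hη0.le, mul_comm,
        Real.rpow_mul hη0.le, Real.rpow_natCast]
      exact Real.rpow_le_rpow (by positivity) hj1 hα0
    rw [Real.norm_of_nonneg (by positivity), Real.norm_of_nonneg (by positivity)] at hfn
    have h2 := h1.trans hfn
    rw [inv_le_iff_one_le_mul₀ (by positivity)] at h2
    rw [hyk, ← mul_div_assoc, div_le_iff₀ hc]
    calc 4 * L ≤ 4 * L * (c / 4 * (n / L) * q ^ j) := le_mul_of_one_le_right (by positivity) h2
      _ = n * q ^ j * c := by field_simp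
  -- The neighbouring grid points.
  have hkx : (k : ℝ) ≤ Real.log n := Nat.floor_le (Real.log_nonneg (by linarith))
  have hkx' : Real.log n < k + 1 := Nat.lt_floor_add_one _
  set i : ℕ := ⌊p * (Real.log n - k)⌋₊ with hi
  have hi1 : (i : ℝ) ≤ p * (Real.log n - k) :=
    Nat.floor_le (mul_nonneg hp0.le (by linarith))
  have hi2 : p * (Real.log n - k) < i + 1 := Nat.lt_floor_add_one _
  have hip : i < p := by
    have h1 : p * (Real.log n - k) < p * 1 := by gcongr; linarith
    have h2 : (i : ℝ) < p := by linarith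
    exact_mod_cast h2
  have hlow : Real.exp (k + i / p) ≤ n := by
    rw [← Real.le_log_iff_exp_le hn0]
    have : (i : ℝ) / p ≤ Real.log n - k := by rw [div_le_iff₀ hp0]; linarith
    linarith
  have hupp : (n : ℝ) ≤ Real.exp (k + ((i + 1 : ℕ) : ℝ) / p) := by
    rw [← Real.log_le_iff_le_exp hn0]
    have : Real.log n - k ≤ ((i + 1 : ℕ) : ℝ) / p := by
      rw [le_div_iff₀ hp0]; push_cast; linarith
    linarith
  have hratio : Real.exp (k + ((i + 1 : ℕ) : ℝ) / p) = Real.exp (1 / p) * Real.exp (k + i / p) := by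
    rw [← Real.exp_add]; congr 1; push_cast; ring
  set e : ℝ := Real.exp (1 / p) with he
  have he0 : 0 < e := Real.exp_pos _
  have he4 : e ≤ 4 := by
    have h1 : e ≤ Real.exp 1 := Real.exp_le_exp.2 hε1.le
    linarith [Real.exp_one_lt_d9]
  set N₁ : ℕ := grid k i with hN₁
  set N₂ : ℕ := grid k (i + 1) with hN₂
  have hN₁n : N₁ ≤ n := Nat.ceil_le.2 hlow
  have hnN₂ : n ≤ N₂ := by
    have : (n : ℝ) ≤ N₂ := hupp.trans (Nat.le_ceil _)
    exact_mod_cast this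
  have hnN₁ : (n : ℝ) ≤ e * N₁ := by
    refine hupp.trans ?_
    rw [hratio]
    exact mul_le_mul_of_nonneg_left (Nat.le_ceil _) he0.le
  have hN₂n : (N₂ : ℝ) ≤ (e + 1 / p) * n := by
    have h1 : (N₂ : ℝ) < Real.exp (k + ((i + 1 : ℕ) : ℝ) / p) + 1 :=
      Nat.ceil_lt_add_one (Real.exp_pos _).le
    rw [hratio] at h1
    have h2 : e * Real.exp (k + i / p) ≤ e * n := mul_le_mul_of_nonneg_left hlow he0.le
    have h3 : (1 : ℝ) ≤ 1 / p * n := by rw [one_div_mul_eq_div, one_le_div hp0]; exact hnp'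
    linarith
  have hqj0 : 0 < q ^ j := by positivity
  have hy0 : 0 < y k := by positivity
  have hyN₁ : y k ≤ N₁ * q ^ j := by
    have h1 : (n : ℝ) * q ^ j ≤ 4 * N₁ * q ^ j := by
      gcongr
      exact hnN₁.trans (by gcongr)
    linarith
  have hyN₂ : y k ≤ N₂ * q ^ j := by
    have h1 : (n : ℝ) * q ^ j ≤ N₂ * q ^ j := by gcongr
    linarith
  have hdev : ∀ i' < p + 1, y k ≤ grid k i' * q ^ j →
      |truncSum T χ (f n) (grid k i') ω - grid k i' * G| ≤ 1 / p * (grid k i' * G) := by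
    intro i' hi' hyi
    by_contra hcon
    exact hgood (Set.mem_biUnion (x := i') (Finset.mem_coe.2 (Finset.mem_range.2 hi'))
      ⟨j, hj, hyi, f n, ⟨hj1, hj2.le⟩, hcon⟩)
  have hd₁ := (abs_le.1 (hdev i (by omega) hyN₁)).1
  have hd₂ := (abs_le.1 (hdev (i + 1) (by omega) hyN₂)).2
  constructor
  · refine le_trans ?_ (truncSum_mono_nat T hD.nonneg (f n) hN₁n ω)
    have h1 : e⁻¹ * (n * G) ≤ N₁ * G := by
      rw [inv_mul_le_iff₀ he0, ← mul_assoc]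
      exact mul_le_mul_of_nonneg_right hnN₁ hG0
    have h2 : (1 - 1 / (p : ℝ)) * (e⁻¹ * (n * G)) ≤ (1 - 1 / p) * (N₁ * G) :=
      mul_le_mul_of_nonneg_left h1 (by linarith)
    linarith
  · refine (truncSum_mono_nat T hD.nonneg (f n) hnN₂ ω).trans ?_
    have h1 : (N₂ : ℝ) * G ≤ (e + 1 / p) * n * G := mul_le_mul_of_nonneg_right hN₂n hG0
    have h2 : (1 + 1 / (p : ℝ)) * (N₂ * G) ≤ (1 + 1 / p) * ((e + 1 / p) * n * G) :=
      mul_le_mul_of_nonneg_left h1 (by linarith)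
    linarith

end Levels

theorem mainTheorem4 {Ω 𝕜 F : Type*} [RCLike 𝕜] [MeasurableSpace Ω] (μ : Measure Ω) (T : Ω → Ω)
    [NormedCommRing F] [NormedAlgebra 𝕜 F] [CompleteSpace F]
    (ι : F →ₗ[𝕜] (Ω →ₘ[μ] 𝕜)) (χ : Ω → ℝ) (hD : PropertyD μ T ι χ)
    (η q R : ℝ) (hη : 1 < η) (hq : 1 / η < q) (hq1 : q < 1) (hR : 0 < R) (hR1 : R < 1 / q)
    (hχ : ∀ k : ℕ, 1 ≤ k → μ.real {ω | χ ω = η ^ k} = R * q ^ k)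
    (f : ℕ → ℝ) (hf : ∀ n, 1 ≤ n → 0 < f n)
    (hFf : ∀ n, 1 ≤ n → 0 < μ {ω | χ ω ≤ f n})
    (hf_lim : Tendsto f atTop atTop)
    (hψ : ∃ ψ ∈ PsiClass,
      (fun n : ℕ => f n ^ (-Real.log q / Real.log η))
        =o[atTop] fun n : ℕ => (n : ℝ) / Real.log (ψ ⌊Real.log n⌋₊)) :
    ∀ᵐ ω ∂μ, Tendsto
      (fun n : ℕ => truncSum T χ (f n) n ω / ∫ ω', truncSum T χ (f n) n ω' ∂μ)
      atTop (𝓝 1) := by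
  have := hD.propertyC.prob
  obtain ⟨ψ, hψ, hfψ⟩ := hψ
  have hη0 : 0 < η := by linarith
  have hq0 : 0 < q := lt_trans (by positivity) hq
  have hall : ∀ᵐ ω ∂μ, ∀ p : ℕ, 2 ≤ p → ∀ᶠ n : ℕ in atTop,
      (1 - 1 / p) * (Real.exp (1 / p))⁻¹ * (n * ∫ ω', upperTrunc χ (f n) ω' ∂μ)
          ≤ truncSum T χ (f n) n ω ∧
        truncSum T χ (f n) n ω
          ≤ (1 + 1 / p) * (Real.exp (1 / p) + 1 / p) * (n * ∫ ω', upperTrunc χ (f n) ω' ∂μ) := by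
    refine ae_all_iff.2 fun p => ?_
    by_cases hp : 2 ≤ p
    · filter_upwards [hD.ae_eventually_le_truncSum_le hη hq0 hq1 hR hχ hf_lim hψ hfψ hp]
        with ω hω _ using hω
    · exact Eventually.of_forall fun ω h => absurd h hp
  have hpos : ∀ᶠ n : ℕ in atTop, 0 < n * ∫ ω, upperTrunc χ (f n) ω ∂μ := by
    filter_upwards [hf_lim.eventually_ge_atTop η, eventually_ge_atTop 1] with n hn hn1
    have h1 := mul_measureReal_le_integral_upperTrunc (μ := μ) hD.measurable hD.nonneg hη0.le
    have h2 := hχ 1 le_rfl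
    rw [pow_one, pow_one] at h2
    rw [h2] at h1
    have h3 := integral_upperTrunc_mono (μ := μ) hD.measurable hD.nonneg hη0.le hn
    have h4 : (0 : ℝ) < n := by exact_mod_cast hn1
    have h5 : 0 < η * (R * q) := by positivity
    exact mul_pos h4 (by linarith)
  have hinv : Tendsto (fun p : ℕ => 1 / (p : ℝ)) atTop (𝓝 0) :=
    tendsto_one_div_atTop_nhds_zero_nat
  have hexp : Tendsto (fun p : ℕ => Real.exp (1 / (p : ℝ))) atTop (𝓝 1) := by
    have h := (Real.continuous_exp.tendsto 0).comp hinv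
    rwa [Real.exp_zero] at h
  have hlow : Tendsto (fun p : ℕ => (1 - 1 / (p : ℝ)) * (Real.exp (1 / p))⁻¹) atTop (𝓝 1) := by
    simpa using (hinv.const_sub 1).mul (hexp.inv₀ one_ne_zero)
  have hupp : Tendsto (fun p : ℕ => (1 + 1 / (p : ℝ)) * (Real.exp (1 / p) + 1 / p)) atTop
      (𝓝 1) := by
    simpa using (hinv.const_add 1).mul (hexp.add hinv)
  filter_upwards [hall] with ω hω
  have hcongr : ∀ᶠ n : ℕ in atTop, ∫ ω', truncSum T χ (f n) n ω' ∂μ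
      = n * ∫ ω', upperTrunc χ (f n) ω' ∂μ := by
    filter_upwards [eventually_ge_atTop 1] with n hn
    exact integral_truncSum hD.propertyC.invariant hD.measurable hD.nonneg (hf n hn).le n
  refine tendsto_order.2 ⟨fun a ha => ?_, fun a ha => ?_⟩
  · obtain ⟨p, hpa, hp2⟩ :=
      ((hlow.eventually (lt_mem_nhds ha)).and (eventually_ge_atTop 2)).exists
    filter_upwards [hω p hp2, hpos, hcongr] with n hn hn0 hc
    rw [hc]
    exact hpa.trans_le ((le_div_iff₀ hn0).2 hn.1)
  · obtain ⟨p, hpa, hp2⟩ :=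
      ((hupp.eventually (gt_mem_nhds ha)).and (eventually_ge_atTop 2)).exists
    filter_upwards [hω p hp2, hpos, hcongr] with n hn hn0 hc
    rw [hc]
    exact ((div_le_iff₀ hn0).2 hn.2).trans_lt hpa
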